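/- **Proposition (Exponential convergence).** Let $(X,\omega)$ be a symplectic manifold of dimension $2n$ (without boundary, not necessarily compact) equipped with a Riemannian metric $g$ with induced distance $d$. Let $L_0,L_1\subset X$ be Lagrangian submanifolds that intersect cleanly, i.e. $L_0\cap L_1$ is a submanifold and $T_q(L_0\cap L_1)=T_qL_0\cap T_qL_1$ for all $q\in L_0\cap L_1$. Let $p\in L_0\cap L_1$ and let $U\subset X$ be the domain of a Darboux chart $\phi=(x_1,\dots,x_n,y_1,\dots,y_n):U\to\mathbb R^{2n}$ centered at $p$ and adapted to $L_0,L_1$, whose image is a Euclidean ball: $\phi(p)=0$, $\phi^*(\sum_i dx_i\wedge dy_i)=\omega|_U$, $\phi(U)=B_\rho(0)$ for some $0<\rho<\infty$, and, for some $0\le m\le n$, $$L_0\cap U=\{x_1=\dots=x_n=0\},\qquad L_1\cap U=\{x_1=\dots=x_m=y_{m+1}=\dots=y_n=0\}.$$ Let $J=(J_t)_{t\in[0,1]}$ be a smooth family of $\omega$-tame almost complex structures on $X$. Then there is a constant $\gamma>0$ with the following property. Let $C=[0,\infty)\times[0,1]$, with coordinates $(s,t)$, and let $u:C\to X$ be a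 smooth map (up to the boundary) such that 1. $u$ is pseudoholomorphic: $\partial_su+J_t(u)\,\partial_tu=0$ on $C$; 2. $u(s,0)\in L_0$ and $u(s,1)\in L_1$ for all $s\ge 0$; 3. the $\omega$-area $\int_C u^*\omega$ is finite; 4. the maps $u(s,\cdot)$ converge uniformly on $[0,1]$ to the constant map $p$ as $s\to\infty$ (so in particular $u(s,\cdot)$ takes values in $U$ for large $s$). Then there is a constant $c_u>0$ (depending on $u$) such that $$d(u(s,t),p)\le c_u\,e^{-\gamma s}\qquad\text{for all } s\ge 0,\ t\in[0,1].$$ -/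

import Mathlib

open Set Filter Topology MeasureTheory
open scoped Manifold ContDiff Bundle

noncomputable section

/-- The model space `ℝ²ⁿ` with its Euclidean norm; the coordinates of `v` are
`x i = v (Sum.inl i)` and `y i = v (Sum.inr i)`. -/
abbrev PhaseSpace (n : ℕ) : Type := EuclideanSpace ℝ (Fin n ⊕ Fin n)

/-- The standard symplectic form `∑ i, dx i ∧ dy i` on `ℝ²ⁿ`. -/
def stdSymplectic {n : ℕ} (v w : PhaseSpace n) : ℝ :=
  ∑ i : Fin n, (v (Sum.inl i) * w (Sum.inr i) - v (Sum.inr i) * w (Sum.inl i))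

section Manifold

variable {n : ℕ} {X : Type*} [TopologicalSpace X] [ChartedSpace (PhaseSpace n) X]

/-- The expression of a 2-form `Ω` on `X` in the chart `e`, that is, the pullback of `Ω` under
`e.symm` (meaningful on `e.target`). -/
def formInChart
    (Ω : ∀ x : X, (TangentSpace 𝓘(ℝ, PhaseSpace n) x) [⋀^Fin 2]→L[ℝ] ℝ)
    (e : OpenPartialHomeomorph X (PhaseSpace n)) (y : PhaseSpace n) :
    PhaseSpace n [⋀^Fin 2]→L[ℝ] ℝ :=
  (Ω (e.symm y)).compContinuousLinearMap
    (mfderiv 𝓘(ℝ, PhaseSpace n) 𝓘(ℝ, PhaseSpace n) e.symm y)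

/-- The expression of a field `A` of endomorphisms of the tangent spaces of `X` in the chart `e`
(meaningful on `e.target`). -/
def endoInChart
    (A : ∀ x : X, TangentSpace 𝓘(ℝ, PhaseSpace n) x →L[ℝ] TangentSpace 𝓘(ℝ, PhaseSpace n) x)
    (e : OpenPartialHomeomorph X (PhaseSpace n)) (y : PhaseSpace n) :
    PhaseSpace n →L[ℝ] PhaseSpace n :=
  (mfderiv 𝓘(ℝ, PhaseSpace n) 𝓘(ℝ, PhaseSpace n) e (e.symm y)).comp
    ((A (e.symm y)).comp (mfderiv 𝓘(ℝ, PhaseSpace n) 𝓘(ℝ, PhaseSpace n) e.symm y))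

/-- A symplectic form: a smooth closed nondegenerate 2-form. -/
structure IsSymplecticForm
    (Ω : ∀ x : X, (TangentSpace 𝓘(ℝ, PhaseSpace n) x) [⋀^Fin 2]→L[ℝ] ℝ) : Prop where
  smooth : ∀ e ∈ IsManifold.maximalAtlas 𝓘(ℝ, PhaseSpace n) ∞ X,
    ContDiffOn ℝ ∞ (formInChart Ω e) e.target
  closed : ∀ e ∈ IsManifold.maximalAtlas 𝓘(ℝ, PhaseSpace n) ∞ X,
    ∀ y ∈ e.target, extDeriv (formInChart Ω e) y = 0
  nondegenerate : ∀ (x : X) (v : TangentSpace 𝓘(ℝ, PhaseSpace n) x),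
    (∀ w : TangentSpace 𝓘(ℝ, PhaseSpace n) x, Ω x ![v, w] = 0) → v = 0

/-- A smooth family `(J t)`, `t ∈ [0,1]`, of almost complex structures on `X` tamed by `Ω`. -/
structure IsTamedFamily
    (Ω : ∀ x : X, (TangentSpace 𝓘(ℝ, PhaseSpace n) x) [⋀^Fin 2]→L[ℝ] ℝ)
    (J : ℝ → ∀ x : X,
      TangentSpace 𝓘(ℝ, PhaseSpace n) x →L[ℝ] TangentSpace 𝓘(ℝ, PhaseSpace n) x) : Prop where
  smooth : ∀ e ∈ IsManifold.maximalAtlas 𝓘(ℝ, PhaseSpace n) ∞ X,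
    ContDiffOn ℝ ∞ (fun q : ℝ × PhaseSpace n => endoInChart (J q.1) e q.2)
      (Icc (0 : ℝ) 1 ×ˢ e.target)
  sq_eq_neg : ∀ t ∈ Icc (0 : ℝ) 1, ∀ (x : X) (v : TangentSpace 𝓘(ℝ, PhaseSpace n) x),
    J t x (J t x v) = -v
  tamed : ∀ t ∈ Icc (0 : ℝ) 1, ∀ (x : X) (v : TangentSpace 𝓘(ℝ, PhaseSpace n) x),
    v ≠ 0 → 0 < Ω x ![v, J t x v]

/-- A subset of `X` is an (embedded, smooth) submanifold if near each of its points it is a linear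
slice in a suitable chart. Different components may have different dimensions. -/
def IsSubmanifold (n : ℕ) {X : Type*} [TopologicalSpace X] [ChartedSpace (PhaseSpace n) X]
    (L : Set X) : Prop :=
  ∀ q ∈ L, ∃ e ∈ IsManifold.maximalAtlas 𝓘(ℝ, PhaseSpace n) ∞ X, q ∈ e.source ∧
    ∃ F : Submodule ℝ (PhaseSpace n), ∀ x ∈ e.source, x ∈ L ↔ e x ∈ F

/-- The tangent space at `q` of the submanifold `L`: all velocities at time `0` of smooth curves
in `L` that pass through `q` at time `0`. -/
def tangentSet (L : Set X) (q : X) : Set (TangentSpace 𝓘(ℝ, PhaseSpace n) q) :=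
  {v | ∃ c : ℝ → X, ContMDiffAt 𝓘(ℝ, ℝ) 𝓘(ℝ, PhaseSpace n) ∞ c 0 ∧ c 0 = q ∧
    (∀ᶠ τ in 𝓝 (0 : ℝ), c τ ∈ L) ∧
    v = (mfderiv 𝓘(ℝ, ℝ) 𝓘(ℝ, PhaseSpace n) c 0 (1 : ℝ) : PhaseSpace n)}

/-- A Lagrangian submanifold: every tangent space is its own `Ω`-orthogonal complement. -/
structure IsLagrangian
    (Ω : ∀ x : X, (TangentSpace 𝓘(ℝ, PhaseSpace n) x) [⋀^Fin 2]→L[ℝ] ℝ) (L : Set X) : Prop where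
  submanifold : IsSubmanifold n L
  self_orthogonal : ∀ q ∈ L, ∀ v : TangentSpace 𝓘(ℝ, PhaseSpace n) q,
    v ∈ tangentSet (n := n) L q ↔ ∀ w ∈ tangentSet (n := n) L q, Ω q ![v, w] = 0

/-- Clean intersection: `L₀ ∩ L₁` is a submanifold with `T(L₀ ∩ L₁) = TL₀ ∩ TL₁`. -/
structure IntersectCleanly (n : ℕ) {X : Type*} [TopologicalSpace X]
    [ChartedSpace (PhaseSpace n) X] (L₀ L₁ : Set X) : Prop where
  submanifold : IsSubmanifold n (L₀ ∩ L₁)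
  tangent : ∀ q ∈ L₀ ∩ L₁,
    tangentSet (n := n) (L₀ ∩ L₁) q = tangentSet (n := n) L₀ q ∩ tangentSet (n := n) L₁ q

/-- `φ` is a Darboux chart of `(X, Ω)` centered at `p`, adapted to `L₀`, `L₁`, whose image is a
Euclidean ball of finite radius; its domain `φ.source` is the Darboux ball. In the coordinates,
`L₀ = {x₁ = ⋯ = xₙ = 0}` and `L₁ = {x₁ = ⋯ = xₘ = yₘ₊₁ = ⋯ = yₙ = 0}` for some `m ≤ n`. -/
structure IsAdaptedDarbouxBall
    (Ω : ∀ x : X, (TangentSpace 𝓘(ℝ, PhaseSpace n) x) [⋀^Fin 2]→L[ℝ] ℝ) (L₀ L₁ : Set X) (p : X)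
    (φ : OpenPartialHomeomorph X (PhaseSpace n)) : Prop where
  mem_maximalAtlas : φ ∈ IsManifold.maximalAtlas 𝓘(ℝ, PhaseSpace n) ∞ X
  mem_source : p ∈ φ.source
  map_center : φ p = 0
  ball : ∃ ρ : ℝ, 0 < ρ ∧ φ.target = Metric.ball 0 ρ
  darboux : ∀ x ∈ φ.source, ∀ v w : TangentSpace 𝓘(ℝ, PhaseSpace n) x,
    stdSymplectic (mfderiv 𝓘(ℝ, PhaseSpace n) 𝓘(ℝ, PhaseSpace n) φ x v)
      (mfderiv 𝓘(ℝ, PhaseSpace n) 𝓘(ℝ, PhaseSpace n) φ x w) = Ω x ![v, w]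
  left_iff : ∀ x ∈ φ.source, x ∈ L₀ ↔ ∀ i : Fin n, φ x (Sum.inl i) = 0
  right_iff : ∃ m ≤ n, ∀ x ∈ φ.source, x ∈ L₁ ↔ ∀ i : Fin n,
    ((i : ℕ) < m → φ x (Sum.inl i) = 0) ∧ (m ≤ (i : ℕ) → φ x (Sum.inr i) = 0)

/-- The half-strip `[0,∞) × [0,1]`, with coordinates `(s, t)`. -/
def halfStrip : Set (ℝ × ℝ) := Ici 0 ×ˢ Icc 0 1

/-- The partial derivative `∂ₛu` of a map on the half-strip. -/
def partialS (u : ℝ × ℝ → X) (z : ℝ × ℝ) : TangentSpace 𝓘(ℝ, PhaseSpace n) (u z) :=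
  mfderivWithin 𝓘(ℝ, ℝ × ℝ) 𝓘(ℝ, PhaseSpace n) u halfStrip z ((1, 0) : ℝ × ℝ)

/-- The partial derivative `∂ₜu` of a map on the half-strip. -/
def partialT (u : ℝ × ℝ → X) (z : ℝ × ℝ) : TangentSpace 𝓘(ℝ, PhaseSpace n) (u z) :=
  mfderivWithin 𝓘(ℝ, ℝ × ℝ) 𝓘(ℝ, PhaseSpace n) u halfStrip z ((0, 1) : ℝ × ℝ)

/-- `u` restricted to the half-strip is smooth up to the boundary and pseudoholomorphic for the
family `(J t)`: `∂ₛu + J t (u) ∂ₜu = 0`. -/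
structure IsHolomorphicHalfStrip
    (J : ℝ → ∀ x : X,
      TangentSpace 𝓘(ℝ, PhaseSpace n) x →L[ℝ] TangentSpace 𝓘(ℝ, PhaseSpace n) x)
    (u : ℝ × ℝ → X) : Prop where
  smooth : ContMDiffOn 𝓘(ℝ, ℝ × ℝ) 𝓘(ℝ, PhaseSpace n) ∞ u halfStrip
  holomorphic : ∀ z ∈ halfStrip,
    partialS (n := n) u z + J z.2 (u z) (partialT (n := n) u z) = 0

/-- The map `u` on the half-strip has finite `Ω`-area: `∫ u^*Ω` converges. -/
def HasFiniteArea
    (Ω : ∀ x : X, (TangentSpace 𝓘(ℝ, PhaseSpace n) x) [⋀^Fin 2]→L[ℝ] ℝ)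
    (u : ℝ × ℝ → X) : Prop :=
  IntegrableOn (fun z => Ω (u z) ![partialS u z, partialT u z]) halfStrip volume

end Manifold

end

/-! Energy gives exponential decay on almost every horizontal line, and a maximum principle carries
it to all lines.

In the Darboux ball the end of `u` becomes a map `w` into `ℝ²ⁿ` with the standard form and two
coordinate Lagrangian planes as boundary conditions. Because the planes are adapted to common
coordinates, the linear form of clean intersection, paths between them satisfy an isoperimetric
inequality `|action| ≤ ∫ ‖x'‖²` (`abs_action_le`). The `s`-derivative of the action `a` is the
energy `e` of the slice (`stripAction_sub`), and tameness bounds `e` below by `κ ∫ ‖∂ₜw‖²`, so `a' =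
e ≥ κ |a|`. Finite area bounds `a` above, which forces `a ≤ 0` and makes the integral of `exp (κ s /
2)` times the energy density finite. By Fubini almost every line `t = const` carries a finite
weighted integral, hence converges at rate `κ / 4` (`IsLocalHolomorphic.ae_exists_decay`).

For the remaining lines, `f = ‖G w‖²` satisfies `Δf ≥ -c f` while `w` is small
(`IsLocalHolomorphic.laplacian_ge`). On a substrip thin compared with `c`, a concave barrier in `t`
transports decay from the two sides to the interior (`le_exp_of_laplacian_ge`). Decaying lines are
dense, so they can serve as sides everywhere except at `t = 0` and `t = 1`. There the map `G` is
chosen to straighten the almost complex structure along the Lagrangian (`exists_straightening`),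
which turns the boundary condition into `∂ₜf = 0`, and this is enough for the maximum principle.
Compactness of `[0,1]` combines finitely many substrips.

The rate depends only on the tameness constant `κ` over a smaller closed ball, so `γ` is chosen
before `u`. Near `p` the distance is controlled by the coordinates, and a compact initial piece only
changes the constant. -/

/-! ### Linear symplectic algebra -/

section LinearAlgebra

variable {n : ℕ}

/-- The standard complex structure on `ℝ²ⁿ`, `(x, y) ↦ (-y, x)`. -/
noncomputable def stdJ (n : ℕ) : PhaseSpace n →L[ℝ] PhaseSpace n :=
  LinearMap.toContinuousLinearMap
    { toFun := fun v => WithLp.toLp 2 (Sum.elim (fun i => -v (Sum.inr i)) (fun i => v (Sum.inl i)))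
      map_add' := by
        intro v w; ext (i | i) <;> simp [add_comm]
      map_smul' := by
        intro c v; ext (i | i) <;> simp }

@[simp] lemma stdJ_inl (v : PhaseSpace n) (i : Fin n) : stdJ n v (Sum.inl i) = -v (Sum.inr i) := rfl

@[simp] lemma stdJ_inr (v : PhaseSpace n) (i : Fin n) : stdJ n v (Sum.inr i) = v (Sum.inl i) := rfl

/-- The projection of `ℝ²ⁿ` onto the Lagrangian coordinate plane
`{x i = 0 for i < m, y i = 0 for i ≥ m}`. -/
noncomputable def lagProj (n m : ℕ) : PhaseSpace n →L[ℝ] PhaseSpace n :=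
  LinearMap.toContinuousLinearMap
    { toFun := fun v => WithLp.toLp 2 (Sum.elim
        (fun i => if (i : ℕ) < m then 0 else v (Sum.inl i))
        (fun i => if (i : ℕ) < m then v (Sum.inr i) else 0))
      map_add' := by
        intro v w; ext (i | i) <;> by_cases h : (i : ℕ) < m <;> simp [h]
      map_smul' := by
        intro c v; ext (i | i) <;> by_cases h : (i : ℕ) < m <;> simp [h] }

@[simp] lemma lagProj_inl (m : ℕ) (v : PhaseSpace n) (i : Fin n) :
    lagProj n m v (Sum.inl i) = if (i : ℕ) < m then 0 else v (Sum.inl i) := rfl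

@[simp] lemma lagProj_inr (m : ℕ) (v : PhaseSpace n) (i : Fin n) :
    lagProj n m v (Sum.inr i) = if (i : ℕ) < m then v (Sum.inr i) else 0 := rfl

lemma lagProj_eq_self_iff (m : ℕ) (v : PhaseSpace n) :
    lagProj n m v = v ↔
      ∀ i : Fin n, ((i : ℕ) < m → v (Sum.inl i) = 0) ∧ (m ≤ (i : ℕ) → v (Sum.inr i) = 0) := by
  constructor
  · intro h i
    have h1 := congrArg (fun w : PhaseSpace n => w (Sum.inl i)) h
    have h2 := congrArg (fun w : PhaseSpace n => w (Sum.inr i)) h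
    simp only [lagProj_inl, lagProj_inr] at h1 h2
    refine ⟨fun hi => ?_, fun hi => ?_⟩
    · simpa [hi] using h1.symm
    · simpa [not_lt.mpr hi] using h2.symm
  · intro h
    ext (i | i)
    · by_cases hi : (i : ℕ) < m
      · simp [hi, (h i).1 hi]
      · simp [hi]
    · by_cases hi : (i : ℕ) < m
      · simp [hi]
      · simp [hi, (h i).2 (not_lt.mp hi)]

@[simp] lemma lagProj_lagProj (m : ℕ) (v : PhaseSpace n) :
    lagProj n m (lagProj n m v) = lagProj n m v := by
  ext (i | i) <;> by_cases h : (i : ℕ) < m <;> simp [h]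

@[simp] lemma lagProj_stdJ_lagProj (m : ℕ) (v : PhaseSpace n) :
    lagProj n m (stdJ n (lagProj n m v)) = 0 := by
  ext (i | i) <;> by_cases h : (i : ℕ) < m <;> simp [h]

/-- `lagProj` keeps one coordinate of each pair `x i`, `y i`, and `stdJ` exchanges the two up to
sign, so together the two projections see every coordinate. -/
lemma eq_zero_of_lagProj (m : ℕ) {v : PhaseSpace n} (h1 : lagProj n m v = 0)
    (h2 : lagProj n m (stdJ n v) = 0) : v = 0 := by
  ext (i | i)
  · have a := congrArg (fun w : PhaseSpace n => w (Sum.inl i)) h1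
    have b := congrArg (fun w : PhaseSpace n => w (Sum.inr i)) h2
    by_cases h : (i : ℕ) < m
    · simpa [h] using b
    · simpa [h] using a
  · have a := congrArg (fun w : PhaseSpace n => w (Sum.inr i)) h1
    have b := congrArg (fun w : PhaseSpace n => w (Sum.inl i)) h2
    by_cases h : (i : ℕ) < m
    · simpa [h] using a
    · simpa [h] using b

lemma stdJ_stdJ (v : PhaseSpace n) : stdJ n (stdJ n v) = -v := by
  ext (i | i) <;> simp

lemma norm_stdJ (v : PhaseSpace n) : ‖stdJ n v‖ = ‖v‖ := by
  rw [EuclideanSpace.norm_eq, EuclideanSpace.norm_eq]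
  congr 1
  simp [Fintype.sum_sum_type, add_comm]

lemma stdSymplectic_eq_inner (v w : PhaseSpace n) :
    stdSymplectic v w = inner ℝ (stdJ n v) w := by
  simp only [stdSymplectic, PiLp.inner_apply, Fintype.sum_sum_type, stdJ_inl, stdJ_inr,
    ← Finset.sum_add_distrib]
  refine Finset.sum_congr rfl fun i _ => ?_
  simp
  ring

lemma inner_stdJ_self (v : PhaseSpace n) : inner ℝ (stdJ n v) v = 0 := by
  rw [← stdSymplectic_eq_inner]
  exact Finset.sum_eq_zero fun i _ => by ring

lemma inner_stdJ_lagProj (m : ℕ) (v w : PhaseSpace n) :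
    inner ℝ (stdJ n (lagProj n m v)) (lagProj n m w) = 0 := by
  rw [← stdSymplectic_eq_inner, stdSymplectic]
  refine Finset.sum_eq_zero fun i _ => ?_
  by_cases h : (i : ℕ) < m <;> simp [h]

/-- For two points of the coordinate Lagrangians with `m = n` and arbitrary `m`, the first point
can be moved into the intersection at a cost bounded by the distance of the points. -/
lemma exists_mem_inter_norm_sub_le {m : ℕ} {v w : PhaseSpace n} (hv : lagProj n n v = v)
    (hw : lagProj n m w = w) :
    ∃ c, lagProj n n c = c ∧ lagProj n m c = c ∧ ‖v - c‖ ≤ ‖w - v‖ := by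
  have hv' := (lagProj_eq_self_iff n v).1 hv
  have hw' := (lagProj_eq_self_iff m w).1 hw
  -- The projection discards from `v` only the `y i` with `i ≥ m`. There `w` vanishes, so the
  -- discarded coordinates reappear up to sign in `w - v`.
  refine ⟨lagProj n m v, ?_, by simp, ?_⟩
  · rw [lagProj_eq_self_iff]
    refine fun i => ⟨fun hi => ?_, fun hi => absurd i.2 (not_lt.mpr hi)⟩
    simp [(hv' i).1 hi]
  · rw [EuclideanSpace.norm_eq, EuclideanSpace.norm_eq]
    refine Real.sqrt_le_sqrt (Finset.sum_le_sum fun k _ => ?_)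
    rcases k with i | i
    · by_cases h : (i : ℕ) < m
      · simp [h, (hv' i).1 i.2]; positivity
      · simp [h]; positivity
    · by_cases h : (i : ℕ) < m
      · simp [h]; positivity
      · simp [h, (hw' i).2 (not_lt.mp h)]

end LinearAlgebra

/-! ### Linear Lagrangians in a Euclidean space with an orthogonal complex structure. -/

section AbstractSymplectic

variable {E : Type*} [NormedAddCommGroup E] [InnerProductSpace ℝ E]

/-- An orthogonal complex structure on a Euclidean space, inducing the symplectic form
`(v, w) ↦ ⟪K v, w⟫`. -/
structure IsOrthogonalComplexStructure (K : E →L[ℝ] E) : Prop where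
  sq_eq_neg : ∀ v, K (K v) = -v
  norm_map : ∀ v, ‖K v‖ = ‖v‖
  inner_self : ∀ v, inner ℝ (K v) v = 0

/-- `P` is a projection onto a subspace which is Lagrangian for `(v, w) ↦ ⟪K v, w⟫`. -/
structure IsLagrangianProjection (K P : E →L[ℝ] E) : Prop where
  idem : ∀ v, P (P v) = P v
  map_rotate : ∀ v, P (K (P v)) = 0
  eq_zero : ∀ v, P v = 0 → P (K v) = 0 → v = 0
  isotropic : ∀ v w, inner ℝ (K (P v)) (P w) = 0

lemma IsOrthogonalComplexStructure.inner_swap {K : E →L[ℝ] E}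
    (hK : IsOrthogonalComplexStructure K) (v w : E) : inner ℝ (K v) w = -inner ℝ (K w) v := by
  have h := hK.inner_self (v + w)
  rw [map_add, inner_add_left, inner_add_right, inner_add_right, hK.inner_self, hK.inner_self] at h
  linarith

lemma IsOrthogonalComplexStructure.abs_inner_le {K : E →L[ℝ] E}
    (hK : IsOrthogonalComplexStructure K) (v w : E) : |inner ℝ (K v) w| ≤ ‖v‖ * ‖w‖ := by
  rw [← hK.norm_map v]
  exact abs_real_inner_le_norm _ _

lemma IsLagrangianProjection.inner_eq_zero {K P : E →L[ℝ] E} (hP : IsLagrangianProjection K P)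
    {v w : E} (hv : P v = v) (hw : P w = w) : inner ℝ (K v) w = 0 := by
  rw [← hv, ← hw]; exact hP.isotropic v w

lemma IsLagrangianProjection.map_rotate_eq_zero {K P : E →L[ℝ] E}
    (hP : IsLagrangianProjection K P) {v : E} (hv : P v = v) : P (K v) = 0 := by
  rw [← hv]; exact hP.map_rotate v

end AbstractSymplectic

lemma isOrthogonalComplexStructure_stdJ (n : ℕ) : IsOrthogonalComplexStructure (stdJ n) :=
  ⟨stdJ_stdJ, norm_stdJ, inner_stdJ_self⟩

lemma isLagrangianProjection_lagProj (n m : ℕ) : IsLagrangianProjection (stdJ n) (lagProj n m) :=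
  ⟨lagProj_lagProj m, lagProj_stdJ_lagProj m, fun _ => eq_zero_of_lagProj m, inner_stdJ_lagProj m⟩

/-! ### Straightening an almost complex structure along a Lagrangian plane -/

section Straightening

variable {E : Type*} [NormedAddCommGroup E] [InnerProductSpace ℝ E] {K P : E →L[ℝ] E}

/-- The linear map `a + c ↦ a + A (P (K c))` for `a` in the Lagrangian plane with projection `P`
and `c` in its orthogonal complement. -/
noncomputable def lagFrame (K P A : E →L[ℝ] E) : E →L[ℝ] E := P + A.comp (P.comp K)

lemma lagFrame_apply (A : E →L[ℝ] E) (v : E) : lagFrame K P A v = P v + A (P (K v)) := rfl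

lemma lagFrame_of_mem (hP : IsLagrangianProjection K P) (A : E →L[ℝ] E) {v : E}
    (hv : P v = v) : lagFrame K P A v = v := by
  rw [lagFrame_apply, hP.map_rotate_eq_zero hv, hv, map_zero, add_zero]

/-- The inverse frame therefore sends the `A`-rotated plane to the `K`-rotated plane. This is the
source of the Neumann condition. -/
lemma lagFrame_rotate (hK : IsOrthogonalComplexStructure K) (hP : IsLagrangianProjection K P)
    (A : E →L[ℝ] E) {v : E} (hv : P v = v) : lagFrame K P A (-K v) = A v := by
  rw [lagFrame_apply, map_neg, hP.map_rotate_eq_zero hv, map_neg, hK.sq_eq_neg, neg_neg, hv,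
    neg_zero, zero_add]

/-- A kernel vector `e` satisfies `A b = -P e` with `b = P (K e)`. Pairing with `K b` gives zero by
isotropy, so tameness forces `b = 0`, then `P e = 0`, and `e` vanishes. -/
lemma isUnit_lagFrame [FiniteDimensional ℝ E] (hP : IsLagrangianProjection K P) (A : E →L[ℝ] E)
    (hA : ∀ v ≠ 0, 0 < inner ℝ (K v) (A v)) : IsUnit (lagFrame K P A) := by
  have hinj : Function.Injective (lagFrame K P A) := by
    rw [injective_iff_map_eq_zero]
    intro e he
    rw [lagFrame_apply] at he
    have hb : P (K e) = 0 := by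
      by_contra hne
      have h := hA _ hne
      rw [eq_neg_of_add_eq_zero_right he, inner_neg_right, hP.isotropic, neg_zero] at h
      exact lt_irrefl _ h
    rw [hb, map_zero, add_zero] at he
    exact hP.eq_zero e he hb
  have hb : Function.Bijective (lagFrame K P A) :=
    ⟨hinj, LinearMap.injective_iff_surjective (f := (lagFrame K P A).toLinearMap).1 hinj⟩
  exact ContinuousLinearMap.isUnit_iff_bijective.2 hb

/-- The straightening map `w ↦ S(P w)⁻¹ w`, where `S(y)` is the frame of `A y`. -/
noncomputable def straighten (K P : E →L[ℝ] E) (A : E → E →L[ℝ] E) (w : E) : E :=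
  Ring.inverse (lagFrame K P (A (P w))) w

lemma contDiffAt_inverse_lagFrame [CompleteSpace E] {A : E → E →L[ℝ] E} {w : E}
    (hA : ContDiffAt ℝ 3 A (P w)) (hu : IsUnit (lagFrame K P (A (P w)))) :
    ContDiffAt ℝ 3 (fun w => Ring.inverse (lagFrame K P (A (P w)))) w := by
  obtain ⟨u, hu⟩ := hu
  have h1 : ContDiffAt ℝ 3 (fun w => lagFrame K P (A (P w))) w := by
    unfold lagFrame
    have h2 : ContDiffAt ℝ 3 (fun w => A (P w)) w :=
      hA.comp w P.contDiff.contDiffAt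
    exact contDiffAt_const.add (h2.clm_comp contDiffAt_const)
  have h3 := contDiffAt_ringInverse ℝ (n := 3) u
  rw [hu] at h3
  exact h3.comp w h1

lemma inverse_lagFrame_of_mem (hP : IsLagrangianProjection K P) {A : E →L[ℝ] E}
    (hu : IsUnit (lagFrame K P A)) {v : E} (hv : P v = v) :
    Ring.inverse (lagFrame K P A) v = v := by
  have h := Ring.inverse_mul_cancel _ hu
  calc Ring.inverse (lagFrame K P A) v
      = Ring.inverse (lagFrame K P A) (lagFrame K P A v) := by rw [lagFrame_of_mem hP _ hv]
    _ = (Ring.inverse (lagFrame K P A) * lagFrame K P A) v := rfl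
    _ = v := by rw [h]; rfl

/-- The inverse frames fix the point `w` of the plane, so the map is `z ↦ N z (z - w) + w` near `w`.
The derivative of `N` is then multiplied by `w - w = 0`, and only `N w` remains. -/
lemma hasFDerivAt_straighten [CompleteSpace E] (hP : IsLagrangianProjection K P)
    {A : E → E →L[ℝ] E} {w : E} (hw : P w = w) (hA : ContDiffAt ℝ 3 A (P w))
    (hu : ∀ᶠ z in 𝓝 w, IsUnit (lagFrame K P (A (P z)))) :
    HasFDerivAt (straighten K P A) (Ring.inverse (lagFrame K P (A w))) w := by
  have hN := ((contDiffAt_inverse_lagFrame hA hu.self_of_nhds).differentiableAt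
    (by norm_num)).hasFDerivAt
  have h2 := (hN.clm_apply ((hasFDerivAt_id w).sub_const w)).add_const w
  have h4 : (Ring.inverse (lagFrame K P (A (P w)))).comp (ContinuousLinearMap.id ℝ E) +
      (fderiv ℝ (fun w => Ring.inverse (lagFrame K P (A (P w)))) w).flip (id w - w) =
      Ring.inverse (lagFrame K P (A w)) := by
    rw [id, sub_self, map_zero, add_zero, hw, ContinuousLinearMap.comp_id]
  rw [h4] at h2
  refine h2.congr_of_eventuallyEq ?_
  filter_upwards [hu] with z hz
  have := inverse_lagFrame_of_mem hP hz hw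
  simp only [id, map_sub, this, straighten]
  abel

lemma eventually_norm_le_of_continuousAt {F H : Type*} [TopologicalSpace F] [NormedAddCommGroup H]
    {f : F → H} {x : F} (hf : ContinuousAt f x) : ∀ᶠ y in 𝓝 x, ‖f y‖ ≤ ‖f x‖ + 1 :=
  (hf.norm.eventually_lt (continuousAt_const (y := ‖f x‖ + 1)) (by linarith)).mono fun _ h => h.le

/-- If the derivative of a map at `x` is bounded below, so are the derivatives at nearby points. -/
lemma eventually_le_norm_apply {F H : Type*} [NormedAddCommGroup F] [NormedSpace ℝ F]
    [NormedAddCommGroup H] [NormedSpace ℝ H] {X : Type*} [TopologicalSpace X]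
    {D : X → F →L[ℝ] H} {x : X} (hD : ContinuousAt D x) {c : ℝ} (hc : 0 ≤ c)
    (hx : ∀ v, ‖v‖ ≤ c * ‖D x v‖) : ∀ᶠ y in 𝓝 x, ∀ v, ‖v‖ ≤ 2 * c * ‖D y v‖ := by
  have e5 : ∀ᶠ y in 𝓝 x, ‖D y - D x‖ * (2 * c) < 1 := by
    have hcon : ContinuousAt (fun y => ‖D y - D x‖ * (2 * c)) x :=
      ((hD.sub continuousAt_const).norm).mul continuousAt_const
    refine hcon.eventually_lt continuousAt_const ?_
    simp
  filter_upwards [e5] with y h6 v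
  have a2 : ‖D x v‖ ≤ ‖D y v‖ + ‖D y - D x‖ * ‖v‖ := by
    calc ‖D x v‖ = ‖D y v - (D y - D x) v‖ := by simp
      _ ≤ ‖D y v‖ + ‖(D y - D x) v‖ := norm_sub_le _ _
      _ ≤ _ := by gcongr; exact ContinuousLinearMap.le_opNorm _ _
  have a3 : c * ‖D x v‖ ≤ c * (‖D y v‖ + ‖D y - D x‖ * ‖v‖) := by gcongr
  have a4 : (‖D y - D x‖ * (2 * c)) * ‖v‖ ≤ 1 * ‖v‖ := by gcongr
  have := hx v
  nlinarith

/-- The properties of a straightening map at a point `w`, with bounds `C`. -/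
structure IsStraighteningAt (K P : E →L[ℝ] E) (A : E → E →L[ℝ] E) (G : E → E) (C : ℝ) (w : E) :
    Prop where
  contDiffAt : ContDiffAt ℝ 3 G w
  norm_le : ‖w‖ ≤ C * ‖G w‖
  norm_map_le : ‖G w‖ ≤ C * ‖w‖
  norm_le_fderiv : ∀ v, ‖v‖ ≤ C * ‖fderiv ℝ G w v‖
  norm_fderiv_le : ‖fderiv ℝ G w‖ ≤ C
  norm_fderiv_fderiv_le : ‖fderiv ℝ (fderiv ℝ G) w‖ ≤ C
  map_eq : P w = w → G w = w
  fderiv_rotate : P w = w → ∀ v, P v = v → fderiv ℝ G w (A w v) = -K v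

set_option synthInstance.maxHeartbeats 200000 in
/-- If `A` is tamed at the origin, the straightening map is a local diffeomorphism with uniform
bounds which fixes the Lagrangian plane and maps `A`-rotated tangent vectors of the plane to
orthogonal vectors. -/
theorem exists_straightening [FiniteDimensional ℝ E] (hK : IsOrthogonalComplexStructure K)
    (hP : IsLagrangianProjection K P) (A : E → E →L[ℝ] E) (hA : ContDiffAt ℝ 3 A 0)
    (htame : ∀ v ≠ 0, 0 < inner ℝ (K v) (A 0 v)) :
    ∃ (G : E → E) (C : ℝ), 0 < C ∧ ∀ᶠ w in 𝓝 (0 : E), IsStraighteningAt K P A G C w := by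
  have : CompleteSpace E := FiniteDimensional.complete ℝ E
  set N : E → E →L[ℝ] E := fun w => Ring.inverse (lagFrame K P (A (P w))) with hN
  set G := straighten K P A with hG
  have hA' : ContDiffAt ℝ 3 A (P 0) := by simpa using hA
  have hPc : Tendsto P (𝓝 0) (𝓝 0) := by
    have := P.continuous.tendsto 0; simpa using this
  have hAev : ∀ᶠ w in 𝓝 (0 : E), ContDiffAt ℝ 3 A (P w) :=
    hPc.eventually (hA.eventually (by simp))
  have hSc : ContinuousAt (fun w => lagFrame K P (A (P w))) 0 := by
    have h2 : ContinuousAt (fun w => A (P w)) 0 :=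
      ContinuousAt.comp (g := A) hA'.continuousAt P.continuous.continuousAt
    unfold lagFrame
    exact continuousAt_const.add (h2.clm_comp continuousAt_const)
  have hu0 : IsUnit (lagFrame K P (A (P 0))) := by
    apply isUnit_lagFrame hP; simpa using htame
  have hUev : ∀ᶠ w in 𝓝 (0 : E), IsUnit (lagFrame K P (A (P w))) :=
    hSc.eventually (Units.isOpen.eventually_mem hu0)
  have hNd : ∀ᶠ w in 𝓝 (0 : E), ContDiffAt ℝ 3 N w := by
    filter_upwards [hAev, hUev] with w h1 h2
    exact contDiffAt_inverse_lagFrame h1 h2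
  have hGd : ∀ᶠ w in 𝓝 (0 : E), ContDiffAt ℝ 3 G w := by
    filter_upwards [hNd] with w h1
    exact h1.clm_apply contDiffAt_id
  have hG0 := hGd.self_of_nhds
  have hG1 : ContDiffAt ℝ 2 (fderiv ℝ G) 0 := hG0.fderiv_right (by norm_num)
  have hG2 : ContDiffAt ℝ 1 (fderiv ℝ (fderiv ℝ G)) 0 := hG1.fderiv_right (by norm_num)
  have hDG0 : fderiv ℝ G 0 = N 0 := by
    have := (hasFDerivAt_straighten hP (A := A) (w := 0) (by simp) hA' hUev).fderiv
    rw [hG, this, hN]; simp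
  set S := fun w => lagFrame K P (A (P w)) with hS
  have hSN : S 0 * N 0 = 1 := Ring.mul_inverse_cancel _ hu0
  have hSN' : ∀ v, ‖v‖ ≤ ‖S 0‖ * ‖fderiv ℝ G 0 v‖ := fun v => by
    rw [hDG0]
    calc ‖v‖ = ‖S 0 (N 0 v)‖ := by
          rw [show S 0 (N 0 v) = (S 0 * N 0) v from rfl, hSN]; rfl
      _ ≤ _ := (S 0).le_opNorm _
  -- Each bound at the origin is relaxed, by `+ 1` for upper bounds and by a factor `2` for the
  -- lower bound on the derivative, so that it persists nearby by continuity.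
  obtain ⟨C, hC⟩ : ∃ C : ℝ, C = max (max (‖S 0‖ + 1) (‖N 0‖ + 1))
    (max (‖fderiv ℝ (fderiv ℝ G) 0‖ + 1) (max (2 * ‖S 0‖) (‖fderiv ℝ G 0‖ + 1))) := ⟨_, rfl⟩
  have c1 : ‖S 0‖ + 1 ≤ C := by rw [hC]; simp
  have c2 : ‖N 0‖ + 1 ≤ C := by rw [hC]; simp
  have c3 : ‖fderiv ℝ (fderiv ℝ G) 0‖ + 1 ≤ C := by rw [hC]; simp
  have c4 : 2 * ‖S 0‖ ≤ C := by rw [hC]; simp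
  have c5 : ‖fderiv ℝ G 0‖ + 1 ≤ C := by rw [hC]; simp
  have hC0 : 0 < C := by have := norm_nonneg (S 0); linarith
  refine ⟨G, C, hC0, ?_⟩
  filter_upwards [hGd, eventually_norm_le_of_continuousAt hSc,
    eventually_norm_le_of_continuousAt hNd.self_of_nhds.continuousAt,
    eventually_norm_le_of_continuousAt hG1.continuousAt,
    eventually_norm_le_of_continuousAt hG2.continuousAt,
    eventually_le_norm_apply hG1.continuousAt (norm_nonneg (S 0)) hSN', hUev,
    hUev.eventually_nhds, hAev] with w h1 h2 h3 h4 h5 h6 h7 h8 h9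
  refine ⟨h1, ?_, ?_, ?_, h4.trans c5, h5.trans c3, fun hw => inverse_lagFrame_of_mem hP h7 hw, ?_⟩
  · have : S w * N w = 1 := Ring.mul_inverse_cancel _ h7
    calc ‖w‖ = ‖S w (N w w)‖ := by
          rw [show S w (N w w) = (S w * N w) w from rfl, this]; rfl
      _ ≤ ‖S w‖ * ‖G w‖ := (S w).le_opNorm _
      _ ≤ C * ‖G w‖ := by gcongr; exact h2.trans c1
  · calc ‖G w‖ ≤ ‖N w‖ * ‖w‖ := (N w).le_opNorm _
      _ ≤ C * ‖w‖ := by gcongr; exact h3.trans c2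
  · intro v
    exact (h6 v).trans (by gcongr)
  · intro hw v hv
    rw [hG, (hasFDerivAt_straighten hP hw h9 h8).fderiv, ← lagFrame_rotate hK hP (A w) hv]
    have hu : IsUnit (lagFrame K P (A w)) := by
      have := h7; rwa [hw] at this
    calc _ = (Ring.inverse (lagFrame K P (A w)) * lagFrame K P (A w)) (-K v) := rfl
      _ = _ := by rw [Ring.inverse_mul_cancel _ hu]; rfl

end Straightening

/-! ### A maximum principle on thin half-strips -/

section MaximumPrinciple

/-- One-sided second derivative test at a maximum, on the right. -/
lemma second_deriv_nonpos_of_max_right {g g' : ℝ → ℝ} {x b c : ℝ} (hxb : x < b)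
    (hg : ∀ y ∈ Icc x b, HasDerivWithinAt g (g' y) (Icc x b) y)
    (hg' : HasDerivWithinAt g' c (Icc x b) x) (h0 : g' x = 0)
    (hmax : ∀ y ∈ Icc x b, g y ≤ g x) : c ≤ 0 := by
  by_contra hc
  push Not at hc
  have h1 : Tendsto (slope g' x) (𝓝[Icc x b \ {x}] x) (𝓝 c) := hasDerivWithinAt_iff_tendsto_slope.1 hg'
  -- Since `g' x = 0`, a positive `c` makes `g'` positive just to the right of `x`, so `g` would
  -- increase strictly there.
  have h2 : ∀ᶠ y in 𝓝[>] x, 0 < g' y := by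
    have h3 : ∀ᶠ y in 𝓝[Icc x b \ {x}] x, 0 < slope g' x y := h1.eventually (lt_mem_nhds hc)
    have hset : 𝓝[Icc x b \ {x}] x = 𝓝[>] x := by
      rw [Icc_sdiff_left, nhdsWithin_Ioc_eq_nhdsGT hxb]
    rw [hset] at h3
    filter_upwards [h3, self_mem_nhdsWithin] with y hy hxy
    rw [slope_def_field, h0, sub_zero] at hy
    have : 0 < y - x := sub_pos.2 hxy
    exact (div_pos_iff_of_pos_right this).1 hy
  obtain ⟨d, hd, hd'⟩ := mem_nhdsGT_iff_exists_Ioc_subset.1 h2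
  set e := min d b with he
  have hxe : x < e := lt_min hd hxb
  have heb : Icc x e ⊆ Icc x b := Icc_subset_Icc_right (min_le_right _ _)
  have hmono : StrictMonoOn g (Icc x e) := by
    refine strictMonoOn_of_hasDerivWithinAt_pos (f' := g') (convex_Icc x e)
      (fun y hy => ((hg y (heb hy)).continuousWithinAt).mono heb) ?_ ?_
    · intro y hy
      rw [interior_Icc] at hy ⊢
      exact (hg y (heb (Ioo_subset_Icc_self hy))).mono (Ioo_subset_Icc_self.trans heb)
    · intro y hy
      rw [interior_Icc] at hy
      exact hd' ⟨hy.1, hy.2.le.trans (min_le_left _ _)⟩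
  have := hmono (left_mem_Icc.2 hxe.le) (right_mem_Icc.2 hxe.le) hxe
  exact absurd (hmax e ⟨hxe.le, min_le_right _ _⟩) (not_le.2 this)

/-- One-sided second derivative test at a maximum, on the left. -/
lemma second_deriv_nonpos_of_max_left {g g' : ℝ → ℝ} {a x c : ℝ} (hax : a < x)
    (hg : ∀ y ∈ Icc a x, HasDerivWithinAt g (g' y) (Icc a x) y)
    (hg' : HasDerivWithinAt g' c (Icc a x) x) (h0 : g' x = 0)
    (hmax : ∀ y ∈ Icc a x, g y ≤ g x) : c ≤ 0 := by
  have hmaps : MapsTo (fun y : ℝ => -y) (Icc (-x) (-a)) (Icc a x) := fun y hy =>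
    ⟨by linarith [hy.2], by linarith [hy.1]⟩
  refine second_deriv_nonpos_of_max_right (g := fun y => g (-y)) (g' := fun y => -g' (-y))
    (x := -x) (b := -a) (c := c) (by linarith) ?_ ?_ (by simp [h0]) ?_
  · intro y hy
    have := (hg (-y) (hmaps hy)).comp y (hasDerivAt_neg y).hasDerivWithinAt hmaps
    simpa [Function.comp_def] using this
  · have h1 : HasDerivWithinAt g' c (Icc a x) (- -x) := by simpa using hg'
    have := (h1.comp (-x) (hasDerivAt_neg (-x)).hasDerivWithinAt hmaps).fun_neg
    simpa [Function.comp_def] using this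
  · intro y hy
    simpa using hmax _ (hmaps hy)

/-- Second derivative test at a maximum over an interval: either the maximum is interior, or the
first derivative is assumed to vanish. -/
lemma second_deriv_nonpos_of_max {g g' : ℝ → ℝ} {a b x c : ℝ} (hab : a < b) (hx : x ∈ Icc a b)
    (hg : ∀ y ∈ Icc a b, HasDerivWithinAt g (g' y) (Icc a b) y)
    (hg' : HasDerivWithinAt g' c (Icc a b) x) (h0 : x ∈ Ioo a b ∨ g' x = 0)
    (hmax : ∀ y ∈ Icc a b, g y ≤ g x) : c ≤ 0 := by
  have h0' : g' x = 0 := by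
    rcases h0 with h | h
    · have hn : Icc a b ∈ 𝓝 x := Icc_mem_nhds h.1 h.2
      have hloc : IsLocalMax g x := by
        filter_upwards [hn] with y hy using hmax y hy
      exact hloc.hasDerivAt_eq_zero ((hg x hx).hasDerivAt hn)
    · exact h
  rcases lt_or_ge x b with h | h
  · have hs : Icc x b ⊆ Icc a b := Icc_subset_Icc_left hx.1
    exact second_deriv_nonpos_of_max_right h (fun y hy => (hg y (hs hy)).mono hs) (hg'.mono hs) h0'
      fun y hy => hmax y (hs hy)
  · have hs : Icc a x ⊆ Icc a b := Icc_subset_Icc_right hx.2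
    exact second_deriv_nonpos_of_max_left (hab.trans_le h) (fun y hy => (hg y (hs hy)).mono hs)
      (hg'.mono hs) h0' fun y hy => hmax y (hs hy)

/-- Exponential decay for solutions of `Δf ≥ -Cf` on a half-strip which is thin compared with `C`,
given exponential decay or a Neumann condition on each of the two sides. -/
theorem le_exp_of_laplacian_ge {f fs fss ft ftt : ℝ → ℝ → ℝ} {s₀ a b τ C γ K M : ℝ}
    (hab : a < b) (hC : 0 ≤ C) (hK : C + γ ^ 2 < K)
    (hτ : ∀ t ∈ Icc a b, K * (t - τ) ^ 2 ≤ 1) (hM : 0 ≤ M)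
    (hcont : ContinuousOn (fun z : ℝ × ℝ => f z.1 z.2) (Ici s₀ ×ˢ Icc a b))
    (hs : ∀ s ∈ Ici s₀, ∀ t ∈ Icc a b,
      HasDerivWithinAt (fun σ => f σ t) (fs s t) (Ici s₀) s)
    (hss : ∀ s ∈ Ici s₀, ∀ t ∈ Icc a b,
      HasDerivWithinAt (fun σ => fs σ t) (fss s t) (Ici s₀) s)
    (ht : ∀ s ∈ Ici s₀, ∀ t ∈ Icc a b, HasDerivWithinAt (f s) (ft s t) (Icc a b) t)
    (htt : ∀ s ∈ Ici s₀, ∀ t ∈ Icc a b, HasDerivWithinAt (ft s) (ftt s t) (Icc a b) t)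
    (hlap : ∀ s ∈ Ici s₀, ∀ t ∈ Icc a b, -C * f s t ≤ fss s t + ftt s t)
    (hlim : ∀ ε > 0, ∃ s₁, ∀ s ≥ s₁, ∀ t ∈ Icc a b, f s t ≤ ε)
    (hleft : ∀ t ∈ Icc a b, f s₀ t ≤ M * Real.exp (-γ * s₀))
    (hside : ∀ t ∈ ({a, b} : Set ℝ), (∀ s ∈ Ici s₀, f s t ≤ M * Real.exp (-γ * s)) ∨
      (t = τ ∧ ∀ s ∈ Ici s₀, ft s t = 0)) :
    ∀ s ∈ Ici s₀, ∀ t ∈ Icc a b, f s t ≤ 2 * M * Real.exp (-γ * s) := by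
  intro s hsS t htT
  by_contra hcon
  push Not at hcon
  have hK0 : 0 < K := by nlinarith
  -- The barrier has values in `[1, 2]`, second derivative `-2K`, and vanishing derivative at `τ`,
  -- where a Neumann side may lie.
  set h : ℝ → ℝ := fun t => 2 - K * (t - τ) ^ 2 with hh
  have h1 : ∀ t ∈ Icc a b, 1 ≤ h t := fun t ht => by have := hτ t ht; simp only [hh]; linarith
  have h2 : ∀ t, h t ≤ 2 := fun t => by simp only [hh]; nlinarith [sq_nonneg (t - τ)]
  set m : ℝ → ℝ := fun s => M * Real.exp (-γ * s) with hm
  have hm0 : ∀ s, 0 ≤ m s := fun s => mul_nonneg hM (Real.exp_pos _).le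
  set v : ℝ × ℝ → ℝ := fun z => f z.1 z.2 / h z.2 - m z.1 with hv
  have hpos : 0 < v (s, t) := by
    simp only [hv]
    have a1 := h1 t htT
    have a2 := h2 t
    rw [sub_pos, lt_div_iff₀ (by linarith)]
    have := hm0 s
    simp only [hm] at *
    nlinarith
  -- Uniform decay of `f` keeps `v` below half of this positive value for `s ≥ s₁`, so the supremum
  -- is attained on a compact rectangle.
  obtain ⟨s₁, hs₁⟩ := hlim (v (s, t) / 2) (by positivity)
  have hss₁ : s < s₁ := by
    by_contra hcon2
    push Not at hcon2
    have a1 := hs₁ s hcon2 t htT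
    have a3 : f s t / h t ≤ v (s, t) / 2 := by
      rw [div_le_iff₀ (by linarith [h1 t htT])]
      nlinarith [h1 t htT]
    have a4 : v (s, t) = f s t / h t - m s := rfl
    have := hm0 s
    linarith
  have hvc : ContinuousOn v (Icc s₀ s₁ ×ˢ Icc a b) := by
    have hsub : Icc s₀ s₁ ×ˢ Icc a b ⊆ Ici s₀ ×ˢ Icc a b :=
      prod_mono Icc_subset_Ici_self Subset.rfl
    refine ((hcont.mono hsub).div (by fun_prop) ?_).sub (by fun_prop)
    intro z hz
    have := h1 z.2 hz.2
    exact ne_of_gt (by linarith)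
  obtain ⟨⟨x, y⟩, ⟨hx, hy⟩, hmax⟩ := (isCompact_Icc.prod isCompact_Icc).exists_isMaxOn
    ⟨(s, t), ⟨⟨hsS, hss₁.le⟩, htT⟩⟩ hvc
  simp only at hx hy
  set D := v (x, y) with hD
  have hDs : v (s, t) ≤ D := hmax ⟨⟨hsS, hss₁.le⟩, htT⟩
  have hDpos : 0 < D := hpos.trans_le hDs
  have hglob : ∀ s' ∈ Ici s₀, ∀ t' ∈ Icc a b, v (s', t') ≤ D := by
    intro s' hs' t' ht'
    rcases le_or_gt s' s₁ with h' | h'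
    · exact hmax ⟨⟨hs', h'⟩, ht'⟩
    · have a1 := hs₁ s' h'.le t' ht'
      have a3 : f s' t' / h t' ≤ v (s, t) / 2 := by
        rw [div_le_iff₀ (by linarith [h1 t' ht'])]
        nlinarith [h1 t' ht']
      have a4 : v (s', t') = f s' t' / h t' - m s' := rfl
      have := hm0 s'
      linarith
  -- Clearing the denominator, `f - (m + D) h` has maximum `0`, attained at `(x, y)`. The second
  -- derivative tests are applied to this difference.
  have hFle : ∀ s' ∈ Ici s₀, ∀ t' ∈ Icc a b, f s' t' - m s' * h t' - D * h t' ≤ 0 := by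
    intro s' hs' t' ht'
    have a1 := hglob s' hs' t' ht'
    have a2 : f s' t' / h t' ≤ D + m s' := by
      have a4 : v (s', t') = f s' t' / h t' - m s' := rfl
      linarith
    rw [div_le_iff₀ (by linarith [h1 t' ht'])] at a2
    linarith
  have hFeq : f x y - m x * h y - D * h y = 0 := by
    have a4 : D = f x y / h y - m x := rfl
    have a5 : h y ≠ 0 := ne_of_gt (by linarith [h1 y hy])
    rw [a4]; field_simp; ring
  have hxS : x ∈ Ici s₀ := hx.1
  -- At the maximum `f = (m + D) h > m`, which excludes the end `s = s₀` and every side with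
  -- prescribed decay.
  have hbig : m x < f x y := by
    have a1 := h1 y hy
    have a2 := hm0 x
    nlinarith
  have hx0 : s₀ < x := by
    rcases hx.1.lt_or_eq with h' | h'
    · exact h'
    · rw [← h'] at hbig
      exact absurd (hleft y hy) (not_le.2 hbig)
  have hmd : ∀ s, HasDerivAt m (-γ * m s) s := by
    intro s
    have := ((((hasDerivAt_id s).const_mul (-γ)).exp).const_mul M)
    convert! this using 1
    simp [hm]; ring
  have hhd : ∀ t, HasDerivAt h (-(2 * K * (t - τ))) t := by
    intro t
    have := ((((hasDerivAt_id t).sub_const τ).pow 2).const_mul K).const_sub 2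
    convert! this using 1
    simp; ring
  have hhdd : ∀ t, HasDerivAt (fun t => -(2 * K * (t - τ))) (-(2 * K)) t := by
    intro t
    have := (((hasDerivAt_id t).sub_const τ).const_mul (2 * K)).neg
    convert! this using 1
    simp
  -- second derivative in the first variable
  have hSS : fss x y - γ ^ 2 * m x * h y ≤ 0 := by
    have hsub : Icc s₀ (x + 1) ⊆ Ici s₀ := Icc_subset_Ici_self
    refine second_deriv_nonpos_of_max (a := s₀) (b := x + 1) (x := x)
      (g := fun σ => f σ y - m σ * h y - D * h y) (g' := fun σ => fs σ y - (-γ * m σ) * h y)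
      (by linarith) ⟨hx.1, by linarith⟩ ?_ ?_ (Or.inl ⟨hx0, by linarith⟩) ?_
    · intro σ hσ
      exact (((hs σ hσ.1 y hy).mono hsub).sub
        ((hmd σ).hasDerivWithinAt.mul_const (h y))).sub_const _
    · have := ((hss x hxS y hy).mono hsub).sub
        (((hmd x).const_mul (-γ)).hasDerivWithinAt.mul_const (h y))
      convert! this using 1
      ring
    · intro σ hσ
      rw [hFeq]
      exact hFle σ hσ.1 y hy
  -- second derivative in the second variable
  have hTT : ftt x y - m x * (-(2 * K)) - D * (-(2 * K)) ≤ 0 := by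
    refine second_deriv_nonpos_of_max (a := a) (b := b) (x := y)
      (g := fun t => f x t - m x * h t - D * h t)
      (g' := fun t => ft x t - m x * (-(2 * K * (t - τ))) - D * (-(2 * K * (t - τ))))
      hab hy ?_ ?_ ?_ ?_
    · intro t ht'
      exact ((ht x hxS t ht').sub ((hhd t).hasDerivWithinAt.const_mul (m x))).sub
        ((hhd t).hasDerivWithinAt.const_mul D)
    · exact ((htt x hxS y hy).sub ((hhdd y).hasDerivWithinAt.const_mul (m x))).sub
        ((hhdd y).hasDerivWithinAt.const_mul D)
    · by_cases hyI : y ∈ Ioo a b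
      · exact Or.inl hyI
      · right
        have hyab : y ∈ ({a, b} : Set ℝ) := by
          by_contra hne
          simp only [mem_insert_iff, mem_singleton_iff, not_or] at hne
          exact hyI ⟨lt_of_le_of_ne hy.1 (Ne.symm hne.1), lt_of_le_of_ne hy.2 hne.2⟩
        rcases hside y hyab with h' | ⟨h', h''⟩
        · exact absurd (h' x hxS) (not_le.2 hbig)
        -- On a Neumann side `t = τ`, both `f` and the barrier have zero `t`-derivative.
        · rw [h'' x hxS, h']; ring
    · intro t' ht'
      rw [hFeq]
      exact hFle x hxS t' ht'
  -- The tests give `Δf ≤ γ² m h - 2K (m + D)`, while `Δf ≥ -C (m + D) h`. With `h ≤ 2`, `D > 0` and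
  -- `K > C + γ²` these are incompatible.
  have hL := hlap x hxS y hy
  have b1 := h1 y hy
  have b2 := h2 y
  have b3 := hm0 x
  have hf : f x y = m x * h y + D * h y := by linarith
  rw [hf] at hL
  have c1 : m x * h y * (C + γ ^ 2) ≤ m x * 2 * (C + γ ^ 2) := by gcongr
  have c2 : D * h y * C ≤ D * 2 * C := by gcongr
  have c3 : m x * (C + γ ^ 2) ≤ m x * K := by gcongr
  have c4 : D * C < D * K := by
    have : C < K := by nlinarith
    gcongr
  nlinarith

end MaximumPrinciple

/-! ### Calculus on half-strips -/

section Strip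

variable {F H : Type*} [NormedAddCommGroup F] [NormedSpace ℝ F]
  [NormedAddCommGroup H] [NormedSpace ℝ H] {s₀ : ℝ}

/-- The half-strip `[s₀, ∞) × [0, 1]`. -/
def strip (s₀ : ℝ) : Set (ℝ × ℝ) := Ici s₀ ×ˢ Icc 0 1

lemma uniqueDiffOn_strip (s₀ : ℝ) : UniqueDiffOn ℝ (strip s₀) :=
  (uniqueDiffOn_Ici s₀).prod (uniqueDiffOn_Icc zero_lt_one)

lemma measurableSet_strip (s₀ : ℝ) : MeasurableSet (strip s₀) :=
  measurableSet_Ici.prod measurableSet_Icc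

lemma interior_strip (s₀ : ℝ) : interior (strip s₀) = Ioi s₀ ×ˢ Ioo 0 1 := by
  rw [strip, interior_prod_eq, interior_Ici, interior_Icc]

lemma strip_subset_closure_interior (s₀ : ℝ) : strip s₀ ⊆ closure (interior (strip s₀)) := by
  rw [interior_strip, closure_prod_eq, closure_Ioi, closure_Ioo zero_ne_one]
  exact Subset.rfl

/-- The derivative in direction `v` of a map on the half-strip. -/
noncomputable def stripDeriv (s₀ : ℝ) (v : ℝ × ℝ) (f : ℝ × ℝ → F) (z : ℝ × ℝ) : F :=
  fderivWithin ℝ f (strip s₀) z v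

lemma ContDiffOn.stripDeriv {f : ℝ × ℝ → F} {k l : WithTop ℕ∞} (hf : ContDiffOn ℝ k f (strip s₀))
    (hl : l + 1 ≤ k) (v : ℝ × ℝ) : ContDiffOn ℝ l (stripDeriv s₀ v f) (strip s₀) :=
  (hf.fderivWithin (uniqueDiffOn_strip s₀) hl).clm_apply contDiffOn_const

lemma HasFDerivWithinAt.stripDeriv_eq {f : ℝ × ℝ → F} {f' : ℝ × ℝ →L[ℝ] F} {z : ℝ × ℝ}
    (hf : HasFDerivWithinAt f f' (strip s₀) z) (hz : z ∈ strip s₀) (v : ℝ × ℝ) :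
    stripDeriv s₀ v f z = f' v := by
  rw [stripDeriv, hf.fderivWithin (uniqueDiffOn_strip s₀ z hz)]

lemma stripDeriv_congr {f g : ℝ × ℝ → F} (h : EqOn f g (strip s₀)) (v : ℝ × ℝ) {z : ℝ × ℝ}
    (hz : z ∈ strip s₀) : stripDeriv s₀ v f z = stripDeriv s₀ v g z := by
  rw [stripDeriv, stripDeriv, fderivWithin_congr h (h hz)]

lemma hasDerivWithinAt_fst {f : ℝ × ℝ → F} (hf : DifferentiableOn ℝ f (strip s₀)) {s t : ℝ}
    (hs : s ∈ Ici s₀) (ht : t ∈ Icc (0 : ℝ) 1) :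
    HasDerivWithinAt (fun σ => f (σ, t)) (stripDeriv s₀ (1, 0) f (s, t)) (Ici s₀) s := by
  have h1 : HasDerivWithinAt (fun σ : ℝ => (σ, t)) ((1 : ℝ), (0 : ℝ)) (Ici s₀) s :=
    ((hasDerivAt_id s).prodMk (hasDerivAt_const s t)).hasDerivWithinAt
  have hm : MapsTo (fun σ : ℝ => (σ, t)) (Ici s₀) (strip s₀) := fun σ hσ => ⟨hσ, ht⟩
  exact (hf (s, t) ⟨hs, ht⟩).hasFDerivWithinAt.comp_hasDerivWithinAt s h1 hm

lemma hasDerivWithinAt_snd {f : ℝ × ℝ → F} (hf : DifferentiableOn ℝ f (strip s₀)) {s t : ℝ}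
    (hs : s ∈ Ici s₀) (ht : t ∈ Icc (0 : ℝ) 1) :
    HasDerivWithinAt (fun τ => f (s, τ)) (stripDeriv s₀ (0, 1) f (s, t)) (Icc 0 1) t := by
  have h1 : HasDerivWithinAt (fun τ : ℝ => (s, τ)) ((0 : ℝ), (1 : ℝ)) (Icc 0 1) t :=
    ((hasDerivAt_const t s).prodMk (hasDerivAt_id t)).hasDerivWithinAt
  have hm : MapsTo (fun τ : ℝ => (s, τ)) (Icc 0 1) (strip s₀) := fun τ hτ => ⟨hs, hτ⟩
  exact (hf (s, t) ⟨hs, ht⟩).hasFDerivWithinAt.comp_hasDerivWithinAt t h1 hm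

/-- Symmetry of second derivatives extends to boundary points because the strip lies in the closure
of its interior. -/
lemma stripDeriv_comm {f : ℝ × ℝ → F} (hf : ContDiffOn ℝ 2 f (strip s₀)) (v w : ℝ × ℝ)
    {z : ℝ × ℝ} (hz : z ∈ strip s₀) :
    stripDeriv s₀ v (stripDeriv s₀ w f) z = stripDeriv s₀ w (stripDeriv s₀ v f) z := by
  have hd : DifferentiableWithinAt ℝ (fderivWithin ℝ f (strip s₀)) (strip s₀) z :=
    ((hf.fderivWithin (uniqueDiffOn_strip s₀) (m := 1) (by norm_num)).differentiableOn
      (by norm_num)) z hz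
  have key : ∀ a b : ℝ × ℝ, stripDeriv s₀ a (stripDeriv s₀ b f) z =
      fderivWithin ℝ (fderivWithin ℝ f (strip s₀)) (strip s₀) z a b := by
    intro a b
    have := hd.hasFDerivWithinAt.clm_apply (hasFDerivWithinAt_const b z (strip s₀))
    refine (this.stripDeriv_eq hz a).trans ?_
    simp
  rw [key, key]
  exact (hf z hz).isSymmSndFDerivWithinAt (by simp) (uniqueDiffOn_strip s₀)
    (strip_subset_closure_interior s₀ hz) hz v w

lemma stripDeriv_comp {g : F → H} {f : ℝ × ℝ → F} {z : ℝ × ℝ} (hz : z ∈ strip s₀)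
    (hg : DifferentiableAt ℝ g (f z)) (hf : DifferentiableWithinAt ℝ f (strip s₀) z) (v : ℝ × ℝ) :
    stripDeriv s₀ v (fun z => g (f z)) z = fderiv ℝ g (f z) (stripDeriv s₀ v f z) :=
  (hg.hasFDerivAt.comp_hasFDerivWithinAt z hf.hasFDerivWithinAt).stripDeriv_eq hz v

lemma stripDeriv_clm_apply {A : ℝ × ℝ → F →L[ℝ] H} {f : ℝ × ℝ → F} {z : ℝ × ℝ}
    (hz : z ∈ strip s₀) (hA : DifferentiableWithinAt ℝ A (strip s₀) z)
    (hf : DifferentiableWithinAt ℝ f (strip s₀) z) (v : ℝ × ℝ) :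
    stripDeriv s₀ v (fun z => A z (f z)) z =
      stripDeriv s₀ v A z (f z) + A z (stripDeriv s₀ v f z) := by
  rw [(hA.hasFDerivWithinAt.clm_apply hf.hasFDerivWithinAt).stripDeriv_eq hz v]
  simp [stripDeriv, add_comm]

end Strip

/-! ### The Laplacian of a holomorphic strip and of its straightened squared norm. -/

section Laplacian

variable {E : Type*} [NormedAddCommGroup E] [InnerProductSpace ℝ E] {s₀ : ℝ}

lemma stripDeriv_inner {f g : ℝ × ℝ → E} {z : ℝ × ℝ} (hz : z ∈ strip s₀)
    (hf : DifferentiableWithinAt ℝ f (strip s₀) z) (hg : DifferentiableWithinAt ℝ g (strip s₀) z)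
    (v : ℝ × ℝ) : stripDeriv s₀ v (fun z => inner ℝ (f z) (g z)) z =
      inner ℝ (f z) (stripDeriv s₀ v g z) + inner ℝ (stripDeriv s₀ v f z) (g z) := by
  rw [(hf.hasFDerivWithinAt.inner ℝ hg.hasFDerivWithinAt).stripDeriv_eq hz v]
  rfl

lemma stripDeriv_norm_sq {q : ℝ × ℝ → E} (hq : DifferentiableOn ℝ q (strip s₀)) {z : ℝ × ℝ}
    (hz : z ∈ strip s₀) (v : ℝ × ℝ) : stripDeriv s₀ v (fun z => inner ℝ (q z) (q z)) z =
      2 * inner ℝ (q z) (stripDeriv s₀ v q z) := by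
  rw [stripDeriv_inner hz (hq z hz) (hq z hz), real_inner_comm (q z)]
  ring

lemma stripDeriv_stripDeriv_norm_sq {q : ℝ × ℝ → E} (hq : ContDiffOn ℝ 2 q (strip s₀))
    {z : ℝ × ℝ} (hz : z ∈ strip s₀) (v : ℝ × ℝ) :
    stripDeriv s₀ v (stripDeriv s₀ v (fun z => inner ℝ (q z) (q z))) z =
      2 * ‖stripDeriv s₀ v q z‖ ^ 2 + 2 * inner ℝ (q z) (stripDeriv s₀ v (stripDeriv s₀ v q) z) := by
  have hd := hq.differentiableOn (by norm_num)
  have hd' : DifferentiableOn ℝ (stripDeriv s₀ v q) (strip s₀) :=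
    (hq.stripDeriv (l := 1) (by norm_num) v).differentiableOn (by norm_num)
  rw [stripDeriv_congr (fun y hy => stripDeriv_norm_sq hd hy v) v hz]
  have h1 := ((hd z hz).hasFDerivWithinAt.inner ℝ (hd' z hz).hasFDerivWithinAt).const_mul 2
  rw [h1.stripDeriv_eq hz v]
  have : ‖stripDeriv s₀ v q z‖ ^ 2 = inner ℝ (fderivWithin ℝ q (strip s₀) z v)
      (stripDeriv s₀ v q z) := (real_inner_self_eq_norm_sq _).symm
  rw [this]
  simp [stripDeriv]
  ring

set_option synthInstance.maxHeartbeats 200000 in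
lemma stripDeriv_stripDeriv_comp {G : E → E} {w : ℝ × ℝ → E} (hw : ContDiffOn ℝ 2 w (strip s₀))
    (hG : ∀ z ∈ strip s₀, ContDiffAt ℝ 3 G (w z)) {z : ℝ × ℝ} (hz : z ∈ strip s₀) (v : ℝ × ℝ) :
    stripDeriv s₀ v (stripDeriv s₀ v (fun z => G (w z))) z =
      fderiv ℝ (fderiv ℝ G) (w z) (stripDeriv s₀ v w z) (stripDeriv s₀ v w z) +
        fderiv ℝ G (w z) (stripDeriv s₀ v (stripDeriv s₀ v w) z) := by
  have hd := hw.differentiableOn (by norm_num)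
  have hd' : DifferentiableOn ℝ (stripDeriv s₀ v w) (strip s₀) :=
    (hw.stripDeriv (l := 1) (by norm_num) v).differentiableOn (by norm_num)
  rw [stripDeriv_congr (g := fun y => fderiv ℝ G (w y) (stripDeriv s₀ v w y))
    (fun y hy => stripDeriv_comp hy ((hG y hy).differentiableAt (by norm_num)) (hd y hy) v) v hz]
  have h2 : DifferentiableAt ℝ (fderiv ℝ G) (w z) :=
    ((hG z hz).fderiv_right (m := 2) (by norm_num)).differentiableAt (by norm_num)
  have h1 : DifferentiableWithinAt ℝ (fun y => fderiv ℝ G (w y)) (strip s₀) z :=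
    h2.comp_differentiableWithinAt z (hd z hz)
  rw [stripDeriv_clm_apply hz h1 (hd' z hz), stripDeriv_comp hz h2 (hd z hz)]

/-- The domain `[0, 1] × B_ρ` of a time-dependent endomorphism field on a ball. -/
def timeBall (E : Type*) [NormedAddCommGroup E] (ρ : ℝ) : Set (ℝ × E) :=
  Icc 0 1 ×ˢ Metric.ball 0 ρ

lemma uniqueDiffOn_timeBall (ρ : ℝ) : UniqueDiffOn ℝ (timeBall E ρ) :=
  (uniqueDiffOn_Icc zero_lt_one).prod Metric.isOpen_ball.uniqueDiffOn

/-- A smooth map on a half-strip, with values in a ball, which is holomorphic for the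
time-dependent endomorphism field `A` with `A² = -1`. -/
structure IsLocalHolomorphic (A : ℝ × E → E →L[ℝ] E) (ρ s₀ : ℝ) (w : ℝ × ℝ → E) : Prop where
  contDiffOn : ContDiffOn ℝ 3 w (strip s₀)
  mem_ball : ∀ z ∈ strip s₀, w z ∈ Metric.ball 0 ρ
  deriv_fst : ∀ z ∈ strip s₀,
    stripDeriv s₀ (1, 0) w z = -A (z.2, w z) (stripDeriv s₀ (0, 1) w z)
  deriv_snd : ∀ z ∈ strip s₀,
    stripDeriv s₀ (0, 1) w z = A (z.2, w z) (stripDeriv s₀ (1, 0) w z)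

variable {A : ℝ × E → E →L[ℝ] E} {ρ : ℝ} {w : ℝ × ℝ → E}

lemma IsLocalHolomorphic.mapsTo (h : IsLocalHolomorphic A ρ s₀ w) :
    MapsTo (fun z : ℝ × ℝ => (z.2, w z)) (strip s₀) (timeBall E ρ) :=
  fun z hz => ⟨hz.2, h.mem_ball z hz⟩

lemma IsLocalHolomorphic.hasFDerivWithinAt_coeff (h : IsLocalHolomorphic A ρ s₀ w)
    (hA : ContDiffOn ℝ 3 A (timeBall E ρ)) {z : ℝ × ℝ} (hz : z ∈ strip s₀) :
    HasFDerivWithinAt (fun z => A (z.2, w z))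
      ((fderivWithin ℝ A (timeBall E ρ) (z.2, w z)).comp
        ((ContinuousLinearMap.snd ℝ ℝ ℝ).prod (fderivWithin ℝ w (strip s₀) z))) (strip s₀) z := by
  have h1 := (hA.differentiableOn (by norm_num) (z.2, w z) (h.mapsTo hz)).hasFDerivWithinAt
  have h2 := (h.contDiffOn.differentiableOn (by norm_num) z hz).hasFDerivWithinAt
  exact h1.comp z (hasFDerivWithinAt_snd.prodMk h2) h.mapsTo

-- Differentiating `∂ₛw = -A ∂ₜw` in `s` and `∂ₜw = A ∂ₛw` in `t`, the mixed second derivatives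
-- cancel and only derivatives of `A` survive. The entry `1` in `(1, ∂ₜw)` is the explicit
-- dependence of `A` on `t`.
set_option synthInstance.maxHeartbeats 200000 in
lemma IsLocalHolomorphic.laplacian_eq (h : IsLocalHolomorphic A ρ s₀ w)
    (hA : ContDiffOn ℝ 3 A (timeBall E ρ)) {z : ℝ × ℝ} (hz : z ∈ strip s₀) :
    stripDeriv s₀ (1, 0) (stripDeriv s₀ (1, 0) w) z +
        stripDeriv s₀ (0, 1) (stripDeriv s₀ (0, 1) w) z =
      fderivWithin ℝ A (timeBall E ρ) (z.2, w z) (1, stripDeriv s₀ (0, 1) w z)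
        (stripDeriv s₀ (1, 0) w z) -
      fderivWithin ℝ A (timeBall E ρ) (z.2, w z) (0, stripDeriv s₀ (1, 0) w z)
        (stripDeriv s₀ (0, 1) w z) := by
  have hc := h.hasFDerivWithinAt_coeff hA hz
  have hd : ∀ v, DifferentiableWithinAt ℝ (stripDeriv s₀ v w) (strip s₀) z := fun v =>
    (h.contDiffOn.stripDeriv (l := 2) (by norm_num) v).differentiableOn (by norm_num) z hz
  have e1 : stripDeriv s₀ (1, 0) (stripDeriv s₀ (1, 0) w) z =
      -stripDeriv s₀ (1, 0) (fun z => A (z.2, w z) (stripDeriv s₀ (0, 1) w z)) z := by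
    rw [stripDeriv_congr h.deriv_fst (1, 0) hz]
    have := (hc.clm_apply (hd (0, 1)).hasFDerivWithinAt)
    rw [this.fun_neg.stripDeriv_eq hz, this.stripDeriv_eq hz]
    rfl
  rw [e1, stripDeriv_congr h.deriv_snd (0, 1) hz,
    stripDeriv_clm_apply hz hc.differentiableWithinAt (hd (0, 1)),
    stripDeriv_clm_apply hz hc.differentiableWithinAt (hd (1, 0)),
    hc.stripDeriv_eq hz, hc.stripDeriv_eq hz,
    stripDeriv_comm (h.contDiffOn.of_le (by norm_num)) (1, 0) (0, 1) hz]
  simp only [ContinuousLinearMap.comp_apply, ContinuousLinearMap.prod_apply,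
    ContinuousLinearMap.coe_snd']
  simp only [stripDeriv]
  abel

/-- Differential inequality `Δ ‖G w‖² ≥ -c ‖G w‖²` for a holomorphic strip of small size. -/
theorem IsLocalHolomorphic.laplacian_ge {K P : E →L[ℝ] E} {B : E → E →L[ℝ] E} {G : E → E} {C L r : ℝ}
    (h : IsLocalHolomorphic A ρ s₀ w)
    (hA : ContDiffOn ℝ 3 A (timeBall E ρ)) (hC : 0 < C) (hL : 0 ≤ L)
    (hr : 2 * C ^ 4 * (1 + L) * r ≤ 1)
    (hG : ∀ z ∈ strip s₀, IsStraighteningAt K P B G C (w z))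
    (hAL : ∀ z ∈ strip s₀, ‖fderivWithin ℝ A (timeBall E ρ) (z.2, w z)‖ ≤ L)
    (hwr : ∀ z ∈ strip s₀, ‖w z‖ ≤ r) {z : ℝ × ℝ} (hz : z ∈ strip s₀) :
    -(C ^ 4 * L ^ 2) * inner ℝ (G (w z)) (G (w z)) ≤
      stripDeriv s₀ (1, 0) (stripDeriv s₀ (1, 0) fun z => inner ℝ (G (w z)) (G (w z))) z +
      stripDeriv s₀ (0, 1) (stripDeriv s₀ (0, 1) fun z => inner ℝ (G (w z)) (G (w z))) z := by
  have hq : ContDiffOn ℝ 2 (fun z => G (w z)) (strip s₀) := fun y hy =>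
    (((hG y hy).contDiffAt.of_le (by norm_num)).comp_contDiffWithinAt y
      ((h.contDiffOn.of_le (by norm_num)) y hy))
  have hw2 : ContDiffOn ℝ 2 w (strip s₀) := h.contDiffOn.of_le (by norm_num)
  have hwd := hw2.differentiableOn (by norm_num)
  have hG3 : ∀ z ∈ strip s₀, ContDiffAt ℝ 3 G (w z) := fun z hz => (hG z hz).contDiffAt
  have hg := hG z hz
  rw [stripDeriv_stripDeriv_norm_sq hq hz, stripDeriv_stripDeriv_norm_sq hq hz,
    stripDeriv_stripDeriv_comp hw2 hG3 hz, stripDeriv_stripDeriv_comp hw2 hG3 hz,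
    stripDeriv_comp hz (hg.contDiffAt.differentiableAt (by norm_num)) (hwd z hz),
    stripDeriv_comp hz (hg.contDiffAt.differentiableAt (by norm_num)) (hwd z hz)]
  have hlap := h.laplacian_eq hA hz
  set a := stripDeriv s₀ (1, 0) w z with ha
  set b := stripDeriv s₀ (0, 1) w z with hb
  set aa := stripDeriv s₀ (1, 0) (stripDeriv s₀ (1, 0) w) z
  set bb := stripDeriv s₀ (0, 1) (stripDeriv s₀ (0, 1) w) z
  set q := G (w z) with hqd
  set D2 := fderiv ℝ (fderiv ℝ G) (w z)
  set D1 := fderiv ℝ G (w z)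
  -- Two errors result: one quadratic in the first derivatives, absorbed because `‖q‖` is small, and
  -- one linear in `‖a‖`, caused by the `t`-dependence of `A`.
  have n1 : ‖aa + bb‖ ≤ L * ‖a‖ + 2 * L * (‖a‖ * ‖b‖) := by
    rw [hlap]
    have hLz := hAL z hz
    have m1 : ‖fderivWithin ℝ A (timeBall E ρ) (z.2, w z) (1, b) a‖ ≤ L * (1 + ‖b‖) * ‖a‖ := by
      refine (ContinuousLinearMap.le_opNorm _ _).trans ?_
      gcongr
      refine (ContinuousLinearMap.le_opNorm _ _).trans ?_
      gcongr
      rw [Prod.norm_def]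
      simp
    have m2 : ‖fderivWithin ℝ A (timeBall E ρ) (z.2, w z) (0, a) b‖ ≤ L * ‖a‖ * ‖b‖ := by
      refine (ContinuousLinearMap.le_opNorm _ _).trans ?_
      gcongr
      refine (ContinuousLinearMap.le_opNorm _ _).trans ?_
      gcongr
      rw [Prod.norm_def]
      simp
    calc _ ≤ _ := norm_sub_le _ _
      _ ≤ L * (1 + ‖b‖) * ‖a‖ + L * ‖a‖ * ‖b‖ := add_le_add m1 m2
      _ = _ := by ring
  have n2 : ∀ v : E, ‖D2 v v‖ ≤ C * ‖v‖ ^ 2 := fun v => by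
    calc ‖D2 v v‖ ≤ ‖D2‖ * ‖v‖ * ‖v‖ := ContinuousLinearMap.le_opNorm₂ _ _ _
      _ ≤ C * ‖v‖ * ‖v‖ := by gcongr; exact hg.norm_fderiv_fderiv_le
      _ = _ := by ring
  have n3 : ‖D1 (aa + bb)‖ ≤ C * (L * ‖a‖ + 2 * L * (‖a‖ * ‖b‖)) := by
    refine (ContinuousLinearMap.le_opNorm _ _).trans ?_
    gcongr
    exact hg.norm_fderiv_le
  have n4 : -(‖q‖ * (C * ‖a‖ ^ 2 + C * ‖b‖ ^ 2 + C * (L * ‖a‖ + 2 * L * (‖a‖ * ‖b‖)))) ≤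
      inner ℝ q (D2 a a + D1 aa) + inner ℝ q (D2 b b + D1 bb) := by
    rw [← inner_add_right, show D2 a a + D1 aa + (D2 b b + D1 bb) =
      D2 a a + D2 b b + D1 (aa + bb) by rw [map_add]; abel]
    refine neg_le_of_abs_le ((abs_real_inner_le_norm _ _).trans ?_)
    gcongr
    exact (norm_add₃_le).trans (add_le_add (add_le_add (n2 a) (n2 b)) n3)
  have n5 : ∀ v : E, ‖v‖ ^ 2 ≤ C ^ 2 * ‖D1 v‖ ^ 2 := fun v => by
    rw [← mul_pow]
    exact pow_le_pow_left₀ (norm_nonneg _) (hg.norm_le_fderiv v) 2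
  have n6 : ‖q‖ ≤ C * r := hg.norm_map_le.trans (by gcongr; exact hwr z hz)
  rw [real_inner_self_eq_norm_sq]
  have hx := norm_nonneg a
  have hy := norm_nonneg b
  have hQ := norm_nonneg q
  have k1 := n5 a
  have k2 := n5 b
  generalize ‖D1 a‖ ^ 2 = da at *
  generalize ‖D1 b‖ ^ 2 = db at *
  generalize ‖a‖ = x at *
  generalize ‖b‖ = y at *
  generalize ‖q‖ = Q at *
  have p1 : 2 * (x * y) ≤ x ^ 2 + y ^ 2 := by nlinarith [sq_nonneg (x - y)]
  have p2 : C ^ 3 * (1 + L) * (2 * Q) ≤ 1 := by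
    calc C ^ 3 * (1 + L) * (2 * Q) ≤ C ^ 3 * (1 + L) * (2 * (C * r)) := by gcongr
      _ = 2 * C ^ 4 * (1 + L) * r := by ring
      _ ≤ 1 := hr
  have p3 : C ^ 2 * (2 * (Q * (C * x ^ 2 + C * y ^ 2 + C * (L * x + 2 * L * (x * y))))) ≤
      (x ^ 2 + y ^ 2) + 2 * C ^ 3 * L * Q * x := by
    have : C ^ 3 * (1 + L) * (2 * Q) * (x ^ 2 + y ^ 2) ≤ 1 * (x ^ 2 + y ^ 2) := by gcongr
    have : C ^ 3 * (2 * Q) * L * (2 * (x * y)) ≤ C ^ 3 * (2 * Q) * L * (x ^ 2 + y ^ 2) := by gcongr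
    nlinarith
  -- Completing the square trades the linear error for a multiple of `Q ^ 2`. This is where the
  -- zeroth-order coefficient `C ^ 4 * L ^ 2` comes from.
  have p4 : 2 * C ^ 3 * L * Q * x ≤ x ^ 2 + C ^ 2 * (C ^ 4 * L ^ 2 * Q ^ 2) := by
    nlinarith [sq_nonneg (x - C ^ 3 * L * Q)]
  have p5 : C ^ 2 * (-(C ^ 4 * L ^ 2) * Q ^ 2) ≤ C ^ 2 * (2 * da + 2 * db +
      2 * -(Q * (C * x ^ 2 + C * y ^ 2 + C * (L * x + 2 * L * (x * y))))) := by
    nlinarith [sq_nonneg y]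
  have p6 := le_of_mul_le_mul_left p5 (by positivity)
  linarith

end Laplacian

/-! ### Propagation of decay across thin substrips. -/

section SubstripDecay

variable {E : Type*} [NormedAddCommGroup E] [InnerProductSpace ℝ E] {s₀ ρ : ℝ}
  {A : ℝ × E → E →L[ℝ] E} {w : ℝ × ℝ → E} {K P : E →L[ℝ] E}

/-- The derivative along a boundary line which is mapped to a subspace lies in the subspace. -/
lemma proj_stripDeriv_fst (hw : DifferentiableOn ℝ w (strip s₀)) {t : ℝ} (ht : t ∈ Icc (0 : ℝ) 1)
    (hP : ∀ s ∈ Ici s₀, P (w (s, t)) = w (s, t)) {s : ℝ} (hs : s ∈ Ici s₀) :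
    P (stripDeriv s₀ (1, 0) w (s, t)) = stripDeriv s₀ (1, 0) w (s, t) := by
  have h1 := hasDerivWithinAt_fst hw hs ht
  have h2 := P.hasFDerivAt.comp_hasDerivWithinAt s h1
  have h3 : HasDerivWithinAt (fun σ => w (σ, t)) (P (stripDeriv s₀ (1, 0) w (s, t))) (Ici s₀) s :=
    h2.congr (fun σ hσ => (hP σ hσ).symm) (hP s hs).symm
  exact (uniqueDiffOn_Ici s₀ s hs).eq_deriv _ h3 h1

/-- Exponential decay propagates from the sides of a thin strip to its interior; on a side on the
boundary of the half-strip, a Lagrangian boundary condition suffices. -/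
theorem IsLocalHolomorphic.exists_decay_substrip {B : E → E →L[ℝ] E} {G : E → E}
    {C L r γ Q a b τ : ℝ} (h : IsLocalHolomorphic A ρ s₀ w)
    (hA : ContDiffOn ℝ 3 A (timeBall E ρ)) (hK : IsLagrangianProjection K P)
    (hC : 0 < C) (hL : 0 ≤ L) (hr : 2 * C ^ 4 * (1 + L) * r ≤ 1)
    (hG : ∀ z ∈ strip s₀, IsStraighteningAt K P B G C (w z))
    (hAL : ∀ z ∈ strip s₀, ‖fderivWithin ℝ A (timeBall E ρ) (z.2, w z)‖ ≤ L)
    (hwr : ∀ z ∈ strip s₀, ‖w z‖ ≤ r)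
    (hlim : ∀ ε > 0, ∃ s₁, ∀ s ≥ s₁, ∀ t ∈ Icc (0 : ℝ) 1, ‖w (s, t)‖ ≤ ε)
    (hab : a < b) (ha : 0 ≤ a) (hb : b ≤ 1) (hQ : C ^ 4 * L ^ 2 + (2 * γ) ^ 2 < Q)
    (hτ : ∀ t ∈ Icc a b, Q * (t - τ) ^ 2 ≤ 1)
    (hside : ∀ t ∈ ({a, b} : Set ℝ),
      (∃ c, ∀ s ∈ Ici s₀, ‖w (s, t)‖ ≤ c * Real.exp (-γ * s)) ∨
      (t = τ ∧ (∀ s ∈ Ici s₀, P (w (s, t)) = w (s, t)) ∧ ∀ y, B y = A (t, y))) :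
    ∃ c, ∀ s ∈ Ici s₀, ∀ t ∈ Icc a b, ‖w (s, t)‖ ≤ c * Real.exp (-γ * s) := by
  have hsub : Icc a b ⊆ Icc (0 : ℝ) 1 := Icc_subset_Icc ha hb
  have hside' : ∃ c : ℝ, ∀ t ∈ ({a, b} : Set ℝ),
      (∀ s ∈ Ici s₀, ‖w (s, t)‖ ≤ c * Real.exp (-γ * s)) ∨
      (t = τ ∧ (∀ s ∈ Ici s₀, P (w (s, t)) = w (s, t)) ∧ ∀ y, B y = A (t, y)) := by
    have key : ∀ t ∈ ({a, b} : Set ℝ), ∃ c, (∀ s ∈ Ici s₀, ‖w (s, t)‖ ≤ c * Real.exp (-γ * s)) ∨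
        (t = τ ∧ (∀ s ∈ Ici s₀, P (w (s, t)) = w (s, t)) ∧ ∀ y, B y = A (t, y)) := by
      intro t ht
      rcases hside t ht with ⟨c, hc⟩ | h'
      · exact ⟨c, Or.inl hc⟩
      · exact ⟨0, Or.inr h'⟩
    obtain ⟨ca, hca⟩ := key a (by simp)
    obtain ⟨cb, hcb⟩ := key b (by simp)
    refine ⟨max ca cb, ?_⟩
    intro t ht
    rcases ht with rfl | rfl
    · exact hca.imp (fun h' s hs => (h' s hs).trans (by gcongr; exact le_max_left _ _)) id
    · exact hcb.imp (fun h' s hs => (h' s hs).trans (by gcongr; exact le_max_right _ _)) id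
  obtain ⟨c, hc⟩ := hside'
  set f : ℝ × ℝ → ℝ := fun z => inner ℝ (G (w z)) (G (w z)) with hf
  have hq : ContDiffOn ℝ 3 (fun z => G (w z)) (strip s₀) := fun y hy =>
    (hG y hy).contDiffAt.comp_contDiffWithinAt y (h.contDiffOn y hy)
  have hwd := h.contDiffOn.differentiableOn (by norm_num)
  have hqd := hq.differentiableOn (by norm_num)
  have hf3 : ContDiffOn ℝ 3 f (strip s₀) := hq.inner ℝ hq
  have hf1 : ∀ v, ContDiffOn ℝ 2 (stripDeriv s₀ v f) (strip s₀) :=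
    fun v => hf3.stripDeriv (by norm_num) v
  have hfd := hf3.differentiableOn (by norm_num)
  have hfd1 := fun v => (hf1 v).differentiableOn (by norm_num)
  have hfle : ∀ z ∈ strip s₀, f z ≤ C ^ 2 * ‖w z‖ ^ 2 := fun z hz => by
    simp only [hf]
    rw [real_inner_self_eq_norm_sq, ← mul_pow]
    exact pow_le_pow_left₀ (norm_nonneg _) (hG z hz).norm_map_le 2
  have hlef : ∀ z ∈ strip s₀, ‖w z‖ ^ 2 ≤ C ^ 2 * f z := fun z hz => by
    simp only [hf]
    rw [real_inner_self_eq_norm_sq, ← mul_pow]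
    exact pow_le_pow_left₀ (norm_nonneg _) (hG z hz).norm_le 2
  have hexp : ∀ s : ℝ, Real.exp (-γ * s) ^ 2 = Real.exp (-(2 * γ) * s) := fun s => by
    rw [← Real.exp_nat_mul]; congr 1; push_cast; ring
  -- The term `c ^ 2` dominates `f` on the decaying sides, and `r ^ 2 * exp (2γ s₀)` dominates it at
  -- `s = s₀`.
  set M : ℝ := C ^ 2 * (c ^ 2 + r ^ 2 * Real.exp (2 * γ * s₀)) with hM
  have hM0 : 0 ≤ M := by positivity
  have hmain := le_exp_of_laplacian_ge (f := fun s t => f (s, t))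
    (fs := fun s t => stripDeriv s₀ (1, 0) f (s, t))
    (fss := fun s t => stripDeriv s₀ (1, 0) (stripDeriv s₀ (1, 0) f) (s, t))
    (ft := fun s t => stripDeriv s₀ (0, 1) f (s, t))
    (ftt := fun s t => stripDeriv s₀ (0, 1) (stripDeriv s₀ (0, 1) f) (s, t))
    (s₀ := s₀) (τ := τ) (C := C ^ 4 * L ^ 2) (γ := 2 * γ) (K := Q) (M := M)
    hab (by positivity) hQ hτ hM0
    (hf3.continuousOn.mono (prod_mono Subset.rfl hsub))
    (fun s hs t ht => hasDerivWithinAt_fst hfd hs (hsub ht))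
    (fun s hs t ht => hasDerivWithinAt_fst (hfd1 _) hs (hsub ht))
    (fun s hs t ht => (hasDerivWithinAt_snd hfd hs (hsub ht)).mono hsub)
    (fun s hs t ht => (hasDerivWithinAt_snd (hfd1 _) hs (hsub ht)).mono hsub)
    (fun s hs t ht => h.laplacian_ge hA hC hL hr hG hAL hwr ⟨hs, hsub ht⟩)
    ?_ ?_ ?_
  · refine ⟨C * Real.sqrt (2 * M), fun s hs t ht => ?_⟩
    have h1 := hmain s hs t ht
    have h2 := hlef (s, t) ⟨hs, hsub ht⟩
    refine le_of_sq_le_sq ?_ (by positivity)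
    calc ‖w (s, t)‖ ^ 2 ≤ C ^ 2 * (2 * M * Real.exp (-(2 * γ) * s)) := h2.trans (by gcongr)
      _ = _ := by rw [mul_pow, mul_pow, Real.sq_sqrt (by positivity), hexp]; ring
  · intro ε hε
    obtain ⟨s₁, hs₁⟩ := hlim (Real.sqrt ε / C) (by positivity)
    refine ⟨max s₁ s₀, fun s hs t ht => ?_⟩
    have h1 := hs₁ s ((le_max_left _ _).trans hs) t (hsub ht)
    calc f (s, t) ≤ C ^ 2 * ‖w (s, t)‖ ^ 2 := hfle _ ⟨(le_max_right _ _).trans hs, hsub ht⟩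
      _ ≤ C ^ 2 * (Real.sqrt ε / C) ^ 2 := by gcongr
      _ = ε := by rw [div_pow, Real.sq_sqrt hε.le]; field_simp
  · intro t ht
    have hz : (s₀, t) ∈ strip s₀ := ⟨self_mem_Ici, hsub ht⟩
    calc f (s₀, t) ≤ C ^ 2 * ‖w (s₀, t)‖ ^ 2 := hfle _ hz
      _ ≤ C ^ 2 * r ^ 2 := by gcongr; exact hwr _ hz
      _ = C ^ 2 * (r ^ 2 * Real.exp (2 * γ * s₀)) * Real.exp (-(2 * γ) * s₀) := by
        rw [mul_assoc, mul_assoc, ← Real.exp_add]; simp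
      _ ≤ M * Real.exp (-(2 * γ) * s₀) := by
        rw [hM]; gcongr; nlinarith [sq_nonneg c]
  · intro t ht
    have htI : t ∈ Icc a b := by
      rcases ht with rfl | rfl
      · exact left_mem_Icc.2 hab.le
      · exact right_mem_Icc.2 hab.le
    rcases hc t ht with h1 | ⟨h1, h2, h3⟩
    · left
      intro s hs
      calc f (s, t) ≤ C ^ 2 * ‖w (s, t)‖ ^ 2 := hfle _ ⟨hs, hsub htI⟩
        _ ≤ C ^ 2 * (c * Real.exp (-γ * s)) ^ 2 := by gcongr; exact h1 s hs
        _ = C ^ 2 * c ^ 2 * Real.exp (-(2 * γ) * s) := by rw [mul_pow, hexp]; ring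
        _ ≤ M * Real.exp (-(2 * γ) * s) := by
          rw [hM]; gcongr
          have : 0 ≤ r ^ 2 * Real.exp (2 * γ * s₀) := by positivity
          linarith
    -- Here `∂ₜf = 2 ⟪G w, DG (A ∂ₛw)⟫ = -2 ⟪w, K ∂ₛw⟫`, which vanishes since `w` and `∂ₛw` lie in
    -- the same Lagrangian plane.
    · right
      refine ⟨h1, fun s hs => ?_⟩
      have hz : (s, t) ∈ strip s₀ := ⟨hs, hsub htI⟩
      have hv := proj_stripDeriv_fst hwd (hsub htI) h2 hs
      rw [hf, stripDeriv_norm_sq hqd hz,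
        stripDeriv_comp hz ((hG _ hz).contDiffAt.differentiableAt (by norm_num)) (hwd _ hz),
        h.deriv_snd _ hz, ← h3, (hG _ hz).fderiv_rotate (h2 s hs) _ hv,
        (hG _ hz).map_eq (h2 s hs), inner_neg_right, real_inner_comm,
        hK.inner_eq_zero hv (h2 s hs)]
      simp

end SubstripDecay

/-! ### Symplectic action and energy -/

section OneDimensional

variable {E : Type*} [NormedAddCommGroup E] [InnerProductSpace ℝ E]

/-- A bounded quantity with `a' ≥ κ |a|` is nonpositive. -/
lemma nonpos_of_deriv_ge {a e : ℝ → ℝ} {s₀ κ M : ℝ} (hκ : 0 < κ)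
    (ha : ∀ s, HasDerivAt a (e s) s) (h : ∀ s ≥ s₀, κ * |a s| ≤ e s) (hM : ∀ s ≥ s₀, a s ≤ M)
    {s : ℝ} (hs : s₀ ≤ s) : a s ≤ 0 := by
  by_contra hpos
  push Not at hpos
  -- From a positive value onwards, `a` grows at least like `exp (κ (x - s))`, against the upper
  -- bound `M`.
  have hd : ∀ x, HasDerivAt (fun x => a x * Real.exp (-κ * (x - s)))
      ((e x - κ * a x) * Real.exp (-κ * (x - s))) x := by
    intro x
    have := (ha x).mul ((((hasDerivAt_id x).sub_const s).const_mul (-κ)).exp)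
    convert! this using 1
    simp; ring
  have hmono : MonotoneOn (fun x => a x * Real.exp (-κ * (x - s))) (Ici s) := by
    refine monotoneOn_of_hasDerivWithinAt_nonneg (convex_Ici s)
      (fun x _ => (hd x).continuousAt.continuousWithinAt)
      (fun x _ => (hd x).hasDerivWithinAt) ?_
    intro x hx
    rw [interior_Ici] at hx
    have h1 := h x (hs.trans (le_of_lt hx))
    have h2 : κ * a x ≤ κ * |a x| := by gcongr; exact le_abs_self _
    exact mul_nonneg (by linarith) (Real.exp_pos _).le
  -- By `exp (κ τ) ≥ κ τ + 1`, growth over time `τ` already gives `a (s + τ) ≥ |M| + a s > M`.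
  set τ := |M| / (κ * a s) with hτ
  have hτ0 : 0 ≤ τ := by positivity
  have h1 := hmono self_mem_Ici (show s + τ ∈ Ici s by simpa using hτ0) (by linarith)
  simp only [sub_self, mul_zero, Real.exp_zero, mul_one, add_sub_cancel_left] at h1
  have h2 := hM (s + τ) (by linarith)
  have h3 : κ * τ + 1 ≤ Real.exp (κ * τ) := Real.add_one_le_exp _
  have h4 : a s * Real.exp (κ * τ) ≤ a (s + τ) := by
    calc a s * Real.exp (κ * τ) ≤ a (s + τ) * Real.exp (-κ * τ) * Real.exp (κ * τ) := by gcongr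
      _ = a (s + τ) := by rw [mul_assoc, ← Real.exp_add]; simp
  have h5 : a s * (κ * τ) = |M| := by rw [hτ]; field_simp
  have h6 : a s * (κ * τ + 1) ≤ a s * Real.exp (κ * τ) := by gcongr
  have := le_abs_self M
  linarith

/-- Weighted integrability of the derivative of a bounded quantity with `a' ≥ κ |a|`. -/
lemma integral_exp_mul_le_of_deriv_ge {a e : ℝ → ℝ} {s₀ κ M : ℝ} (hκ : 0 < κ) (he : Continuous e)
    (ha : ∀ s, HasDerivAt a (e s) s) (h : ∀ s ≥ s₀, κ * |a s| ≤ e s) (hM : ∀ s ≥ s₀, a s ≤ M)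
    {b : ℝ} (hb : s₀ ≤ b) :
    ∫ σ in s₀..b, Real.exp (κ / 2 * σ) * e σ ≤ -2 * Real.exp (κ / 2 * s₀) * a s₀ := by
  have hc : Continuous fun σ => Real.exp (κ / 2 * σ) * e σ := by fun_prop
  -- The factor `2` makes the derivative `exp (κ x / 2) (κ a + e) ≥ 0`. At `b` the boundary term
  -- drops out since `a b ≤ 0`.
  have hd : ∀ x, HasDerivAt (fun x => 2 * Real.exp (κ / 2 * x) * a x -
      ∫ σ in s₀..x, Real.exp (κ / 2 * σ) * e σ) (Real.exp (κ / 2 * x) * (κ * a x + e x)) x := by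
    intro x
    have h1 := ((((hasDerivAt_id x).const_mul (κ / 2)).exp).const_mul 2).mul (ha x)
    have h2 := hc.integral_hasStrictDerivAt s₀ x
    convert! h1.sub h2.hasDerivAt using 1
    simp; ring
  have hmono : MonotoneOn (fun x => 2 * Real.exp (κ / 2 * x) * a x -
      ∫ σ in s₀..x, Real.exp (κ / 2 * σ) * e σ) (Ici s₀) := by
    refine monotoneOn_of_hasDerivWithinAt_nonneg (convex_Ici s₀)
      (fun x _ => (hd x).continuousAt.continuousWithinAt)
      (fun x _ => (hd x).hasDerivWithinAt) ?_
    intro x hx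
    rw [interior_Ici] at hx
    have h1 := h x (le_of_lt hx)
    have h2 : κ * -a x ≤ κ * |a x| := by gcongr; exact neg_le_abs _
    exact mul_nonneg (Real.exp_pos _).le (by linarith)
  have h1 := hmono self_mem_Ici (show b ∈ Ici s₀ from hb) hb
  simp only [intervalIntegral.integral_same, sub_zero] at h1
  have h2 := nonpos_of_deriv_ge hκ ha h hM hb
  have h3 : 2 * Real.exp (κ / 2 * b) * a b ≤ 0 :=
    mul_nonpos_of_nonneg_of_nonpos (by positivity) h2
  linarith

/-- Isoperimetric inequality for paths between two linear Lagrangians. -/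
lemma abs_action_le {K P₀ P₁ : E →L[ℝ] E} (hK : IsOrthogonalComplexStructure K)
    (hP₀ : IsLagrangianProjection K P₀) (hP₁ : IsLagrangianProjection K P₁)
    (hinter : ∀ v w, P₀ v = v → P₁ w = w → ∃ c, P₀ c = c ∧ P₁ c = c ∧ ‖v - c‖ ≤ ‖w - v‖)
    [CompleteSpace E] {x x' : ℝ → E}
    (hx : ∀ t ∈ Icc (0 : ℝ) 1, HasDerivWithinAt x (x' t) (Icc 0 1) t)
    (hx' : ContinuousOn x' (Icc 0 1)) (h0 : P₀ (x 0) = x 0) (h1 : P₁ (x 1) = x 1) :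
    |1 / 2 * ∫ t in (0 : ℝ)..1, inner ℝ (K (x t)) (x' t)| ≤ ∫ t in (0 : ℝ)..1, ‖x' t‖ ^ 2 := by
  -- Translating by a point `c` of both Lagrangians leaves the action unchanged, because `⟪K c, x'⟫`
  -- integrates to pairings that vanish at both ends. The translated path is bounded by twice its
  -- length.
  obtain ⟨c, hc0, hc1, hc⟩ := hinter _ _ h0 h1
  have hxc : ContinuousOn x (Icc 0 1) := fun t ht => (hx t ht).continuousWithinAt
  have hu : uIcc (0 : ℝ) 1 = Icc 0 1 := uIcc_of_le zero_le_one
  have hftc : ∀ t ∈ Icc (0 : ℝ) 1, ∫ τ in (0 : ℝ)..t, x' τ = x t - x 0 := by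
    intro t ht
    have hst : Icc 0 t ⊆ Icc (0 : ℝ) 1 := Icc_subset_Icc_right ht.2
    refine intervalIntegral.integral_eq_sub_of_hasDeriv_right_of_le ht.1 (hxc.mono hst)
      (fun τ hτ => ?_) ?_
    · have hτ' : τ ∈ Icc (0 : ℝ) 1 := hst (Ioo_subset_Icc_self hτ)
      exact ((hx τ hτ').hasDerivAt (Icc_mem_nhds hτ.1 (hτ.2.trans_le ht.2))).hasDerivWithinAt
    · exact ContinuousOn.intervalIntegrable (by rw [uIcc_of_le ht.1]; exact hx'.mono hst)
  set I := ∫ t in (0 : ℝ)..1, ‖x' t‖ with hI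
  have hin : IntervalIntegrable (fun t => ‖x' t‖) volume 0 1 :=
    ContinuousOn.intervalIntegrable (by rw [hu]; exact hx'.norm)
  have hin2 : IntervalIntegrable (fun t => ‖x' t‖ ^ 2) volume 0 1 :=
    ContinuousOn.intervalIntegrable (by rw [hu]; exact hx'.norm.pow 2)
  have hin3 : IntervalIntegrable x' volume 0 1 :=
    ContinuousOn.intervalIntegrable (by rw [hu]; exact hx')
  have hdist : ∀ t ∈ Icc (0 : ℝ) 1, ‖x t - x 0‖ ≤ I := by
    intro t ht
    rw [← hftc t ht]
    refine (intervalIntegral.norm_integral_le_integral_norm ht.1).trans ?_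
    exact intervalIntegral.integral_mono_interval le_rfl ht.1 ht.2
      (ae_of_all _ fun _ => norm_nonneg _) hin
  have hdc : ∀ t ∈ Icc (0 : ℝ) 1, ‖x t - c‖ ≤ 2 * I := by
    intro t ht
    have a1 := hdist t ht
    have a2 := hdist 1 (right_mem_Icc.2 zero_le_one)
    calc ‖x t - c‖ = ‖(x t - x 0) + (x 0 - c)‖ := by congr 1; abel
      _ ≤ ‖x t - x 0‖ + ‖x 0 - c‖ := norm_add_le _ _
      _ ≤ 2 * I := by linarith
  have hKx : ContinuousOn (fun t => inner ℝ (K (x t)) (x' t)) (Icc 0 1) :=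
    (K.continuous.comp_continuousOn hxc).inner hx'
  have hKc : ContinuousOn (fun t => inner ℝ (K c) (x' t)) (Icc 0 1) :=
    continuousOn_const.inner hx'
  have hzero : ∫ t in (0 : ℝ)..1, inner ℝ (K c) (x' t) = 0 := by
    have : ∫ t in (0 : ℝ)..1, innerSL ℝ (K c) (x' t) = innerSL ℝ (K c) (∫ t in (0 : ℝ)..1, x' t) :=
      ContinuousLinearMap.intervalIntegral_comp_comm _ hin3
    rw [hftc 1 (right_mem_Icc.2 zero_le_one)] at this
    simp only [innerSL_apply_apply] at this
    rw [this, inner_sub_right, hP₁.inner_eq_zero hc1 h1, hP₀.inner_eq_zero hc0 h0, sub_zero]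
  have hmain : |∫ t in (0 : ℝ)..1, inner ℝ (K (x t)) (x' t)| ≤ 2 * I * I := by
    have e1 : ∫ t in (0 : ℝ)..1, inner ℝ (K (x t)) (x' t) =
        ∫ t in (0 : ℝ)..1, inner ℝ (K (x t - c)) (x' t) := by
      simp only [map_sub, inner_sub_left]
      rw [intervalIntegral.integral_sub, hzero, sub_zero]
      · exact ContinuousOn.intervalIntegrable (by rw [hu]; exact hKx)
      · exact ContinuousOn.intervalIntegrable (by rw [hu]; exact hKc)
    rw [e1, ← Real.norm_eq_abs]
    calc _ ≤ ∫ t in (0 : ℝ)..1, 2 * I * ‖x' t‖ := by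
          refine intervalIntegral.norm_integral_le_of_norm_le zero_le_one ?_ (hin.const_mul _)
          refine ae_of_all _ fun t ht => ?_
          rw [Real.norm_eq_abs]
          refine (hK.abs_inner_le _ _).trans ?_
          gcongr
          exact hdc t (Ioc_subset_Icc_self ht)
      _ = 2 * I * I := by rw [intervalIntegral.integral_const_mul]
  -- Cauchy–Schwarz on the unit interval, as nonnegativity of the variance of the speed.
  have hcs : I * I ≤ ∫ t in (0 : ℝ)..1, ‖x' t‖ ^ 2 := by
    have h2 : 0 ≤ ∫ t in (0 : ℝ)..1, (‖x' t‖ - I) ^ 2 :=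
      intervalIntegral.integral_nonneg zero_le_one fun t _ => sq_nonneg _
    have h3 : ∫ t in (0 : ℝ)..1, (‖x' t‖ - I) ^ 2 =
        (∫ t in (0 : ℝ)..1, ‖x' t‖ ^ 2) - 2 * I * I + I * I := by
      have : ∀ t, (‖x' t‖ - I) ^ 2 = ‖x' t‖ ^ 2 - 2 * I * ‖x' t‖ + I * I := fun t => by ring
      simp only [this]
      rw [intervalIntegral.integral_add (hin2.sub (hin.const_mul _)) (by simp),
        intervalIntegral.integral_sub hin2 (hin.const_mul _), intervalIntegral.integral_const_mul]
      simp [hI]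
    linarith
  rw [abs_mul, abs_of_pos (by norm_num : (0 : ℝ) < 1 / 2)]
  linarith

/-- A path converging to zero whose squared speed has an exponentially weighted integral decays
exponentially. -/
lemma exists_norm_le_exp_of_integrable [CompleteSpace E] {x x' : ℝ → E} {e : ℝ → ℝ} {s₀ κ Λ : ℝ}
    (hκ : 0 < κ) (hx : ∀ s ∈ Ici s₀, HasDerivWithinAt x (x' s) (Ici s₀) s)
    (hx' : ContinuousOn x' (Ici s₀)) (he0 : ∀ s ∈ Ici s₀, 0 ≤ e s) (hΛ : 0 ≤ Λ)
    (hxe : ∀ s ∈ Ici s₀, ‖x' s‖ ^ 2 ≤ Λ * e s)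
    (he : IntegrableOn (fun s => Real.exp (κ / 2 * s) * e s) (Ici s₀))
    (hlim : Tendsto x atTop (𝓝 0)) :
    ∃ c, ∀ s ∈ Ici s₀, ‖x s‖ ≤ c * Real.exp (-(κ / 4) * s) := by
  set W := ∫ s in Ici s₀, Real.exp (κ / 2 * s) * e s with hW
  refine ⟨2 / κ + Λ / 2 * W, fun s hs => ?_⟩
  have hbd : ∀ b ≥ s, ‖x b - x s‖ ≤ (2 / κ + Λ / 2 * W) * Real.exp (-(κ / 4) * s) := by
    intro b hb
    have hsub : Icc s b ⊆ Ici s₀ := fun y hy => hs.trans hy.1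
    have hxc : ContinuousOn x (Icc s b) := fun t ht => ((hx t (hsub ht)).continuousWithinAt).mono hsub
    have hftc : ∫ τ in s..b, x' τ = x b - x s := by
      refine intervalIntegral.integral_eq_sub_of_hasDeriv_right_of_le hb hxc (fun τ hτ => ?_) ?_
      · have hτ' := hsub (Ioo_subset_Icc_self hτ)
        exact ((hx τ hτ').hasDerivAt (Ici_mem_nhds (lt_of_le_of_lt hs hτ.1))).hasDerivWithinAt
      · exact ContinuousOn.intervalIntegrable (by rw [uIcc_of_le hb]; exact hx'.mono hsub)
    have hsub' : Ioc s b ⊆ Ici s₀ := Ioc_subset_Icc_self.trans hsub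
    have hin1 : IntervalIntegrable (fun σ => Real.exp (κ / 2 * σ) * e σ) volume s b := by
      rw [intervalIntegrable_iff_integrableOn_Ioc_of_le hb]
      exact he.mono_set hsub'
    have hin2 : IntervalIntegrable (fun σ => Real.exp (-(κ / 4) * σ)) volume s b :=
      Continuous.intervalIntegrable (by fun_prop) _ _
    rw [← hftc]
    have h1 : ∀ σ ∈ Ioc s b, ‖x' σ‖ ≤ 1 / 2 * Real.exp (-(κ / 4) * σ) +
        Λ / 2 * Real.exp (-(κ / 4) * s) * (Real.exp (κ / 2 * σ) * e σ) := by
      intro σ hσ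
      have a1 := hxe σ (hsub' hσ)
      have a2 := he0 σ (hsub' hσ)
      set p := Real.exp (-(κ / 4) * σ) with hp
      have hp0 : 0 < p := Real.exp_pos _
      have a3 : Real.exp (κ / 2 * σ) = (p⁻¹) ^ 2 := by
        rw [hp, ← Real.exp_neg, ← Real.exp_nat_mul]; congr 1; push_cast; ring
      -- The inequality of means weighted by `p = exp (-κ σ / 4)`: the first term integrates to the
      -- desired rate, and `p⁻¹ = p * exp (κ σ / 2)` produces the integrable weight with a decaying
      -- factor to spare.
      have a4 : ‖x' σ‖ ≤ 1 / 2 * p + 1 / 2 * (p⁻¹ * ‖x' σ‖ ^ 2) := by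
        have := sq_nonneg (p - ‖x' σ‖)
        have a5 : 0 ≤ p⁻¹ * (p - ‖x' σ‖) ^ 2 := by positivity
        have a6 : p⁻¹ * (p - ‖x' σ‖) ^ 2 = p - 2 * ‖x' σ‖ + p⁻¹ * ‖x' σ‖ ^ 2 := by
          field_simp; ring
        linarith
      have a7 : p ≤ Real.exp (-(κ / 4) * s) := by
        rw [hp]; apply Real.exp_le_exp.2; nlinarith [hσ.1]
      calc ‖x' σ‖ ≤ 1 / 2 * p + 1 / 2 * (p⁻¹ * ‖x' σ‖ ^ 2) := a4
        _ ≤ 1 / 2 * p + 1 / 2 * (p⁻¹ * (Λ * e σ)) := by gcongr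
        _ = 1 / 2 * p + Λ / 2 * p * ((p⁻¹) ^ 2 * e σ) := by field_simp
        _ ≤ _ := by rw [a3]; gcongr
    calc ‖∫ τ in s..b, x' τ‖ ≤ ∫ σ in s..b, (1 / 2 * Real.exp (-(κ / 4) * σ) +
        Λ / 2 * Real.exp (-(κ / 4) * s) * (Real.exp (κ / 2 * σ) * e σ)) :=
          intervalIntegral.norm_integral_le_of_norm_le hb (ae_of_all _ h1)
            ((hin2.const_mul _).add (hin1.const_mul _))
      _ = 1 / 2 * (∫ σ in s..b, Real.exp (-(κ / 4) * σ)) +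
          Λ / 2 * Real.exp (-(κ / 4) * s) * ∫ σ in s..b, Real.exp (κ / 2 * σ) * e σ := by
        rw [intervalIntegral.integral_add (hin2.const_mul _) (hin1.const_mul _),
          intervalIntegral.integral_const_mul, intervalIntegral.integral_const_mul]
      _ ≤ 1 / 2 * (4 / κ * Real.exp (-(κ / 4) * s)) + Λ / 2 * Real.exp (-(κ / 4) * s) * W := by
        gcongr
        · have hd : ∀ y ∈ uIcc s b, HasDerivAt (fun y => -(4 / κ) * Real.exp (-(κ / 4) * y))
              (Real.exp (-(κ / 4) * y)) y := by
            intro y _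
            have := ((((hasDerivAt_id y).const_mul (-(κ / 4))).exp).const_mul (-(4 / κ)))
            convert! this using 1
            simp; field_simp
          rw [intervalIntegral.integral_eq_sub_of_hasDerivAt hd hin2]
          have : 0 < 4 / κ * Real.exp (-(κ / 4) * b) := by positivity
          linarith
        · rw [intervalIntegral.integral_of_le hb]
          refine setIntegral_mono_set he ?_ hsub'.eventuallyLE
          filter_upwards [ae_restrict_mem measurableSet_Ici] with σ hσ
          exact mul_nonneg (Real.exp_pos _).le (he0 σ hσ)
      _ = _ := by field_simp; ring
  have hl : Tendsto (fun b => ‖x b - x s‖) atTop (𝓝 ‖0 - x s‖) := (hlim.sub_const _).norm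
  have := le_of_tendsto hl (eventually_atTop.2 ⟨s, hbd⟩)
  simpa using this

end OneDimensional

/-! ### Action–energy identity, weighted energy and decay on almost every line. -/

section Energy

variable {E : Type*} [NormedAddCommGroup E] [InnerProductSpace ℝ E] {s₀ : ℝ}
  {w : ℝ × ℝ → E} {K P₀ P₁ : E →L[ℝ] E}

/-- The energy density `ω(∂ₛw, ∂ₜw)` of a map on the half-strip. -/
noncomputable def energyDensity (K : E →L[ℝ] E) (s₀ : ℝ) (w : ℝ × ℝ → E) (z : ℝ × ℝ) : ℝ :=
  inner ℝ (K (stripDeriv s₀ (1, 0) w z)) (stripDeriv s₀ (0, 1) w z)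

/-- The symplectic action of the path `w(s, ·)`. -/
noncomputable def stripAction (K : E →L[ℝ] E) (s₀ : ℝ) (w : ℝ × ℝ → E) (s : ℝ) : ℝ :=
  1 / 2 * ∫ t in (0 : ℝ)..1, inner ℝ (K (w (s, t))) (stripDeriv s₀ (0, 1) w (s, t))

lemma continuousOn_energyDensity (hw : ContDiffOn ℝ 3 w (strip s₀)) :
    ContinuousOn (energyDensity K s₀ w) (strip s₀) := by
  have h := fun v => (hw.stripDeriv (l := 2) (by norm_num) v).continuousOn
  exact (K.continuous.comp_continuousOn (h (1, 0))).inner (h (0, 1))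

lemma Icc_prod_subset_strip {a b : ℝ} (ha : s₀ ≤ a) : Icc a b ×ˢ Icc (0 : ℝ) 1 ⊆ strip s₀ :=
  prod_mono (Icc_subset_Ici_self.trans (Ici_subset_Ici.2 ha)) Subset.rfl

/-- The energy on a rectangle is the difference of the actions of its ends. -/
lemma stripAction_sub (hK : IsOrthogonalComplexStructure K) (hP₀ : IsLagrangianProjection K P₀)
    (hP₁ : IsLagrangianProjection K P₁) (hw : ContDiffOn ℝ 3 w (strip s₀))
    (h0 : ∀ s ∈ Ici s₀, P₀ (w (s, 0)) = w (s, 0)) (h1 : ∀ s ∈ Ici s₀, P₁ (w (s, 1)) = w (s, 1))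
    {a b : ℝ} (ha : s₀ ≤ a) (hab : a ≤ b) :
    stripAction K s₀ w b - stripAction K s₀ w a =
      ∫ s in a..b, ∫ t in (0 : ℝ)..1, energyDensity K s₀ w (s, t) := by
  have hwd := hw.differentiableOn (by norm_num)
  have hw2 : ∀ v, ContDiffOn ℝ 2 (stripDeriv s₀ v w) (strip s₀) :=
    fun v => hw.stripDeriv (by norm_num) v
  have hKw : ContDiffOn ℝ 2 (fun z => K (w z)) (strip s₀) :=
    K.contDiff.comp_contDiffOn (hw.of_le (by norm_num))
  -- These are the components of the pullback of the primitive `½ ω(w, dw)`, arranged so that the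
  -- divergence `∂ₛf + ∂ₜg` is the energy density.
  set f : ℝ × ℝ → ℝ := fun z => 1 / 2 * inner ℝ (K (w z)) (stripDeriv s₀ (0, 1) w z) with hf
  set g : ℝ × ℝ → ℝ := fun z => -(1 / 2) * inner ℝ (K (w z)) (stripDeriv s₀ (1, 0) w z) with hg
  have hfc : ContDiffOn ℝ 2 f (strip s₀) := contDiffOn_const.mul (hKw.inner ℝ (hw2 _))
  have hgc : ContDiffOn ℝ 2 g (strip s₀) := contDiffOn_const.mul (hKw.inner ℝ (hw2 _))
  have hKv : ∀ v, ∀ z ∈ strip s₀, stripDeriv s₀ v (fun z => K (w z)) z = K (stripDeriv s₀ v w z) :=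
    fun v z hz => by rw [stripDeriv_comp hz K.differentiableAt (hwd z hz) v, K.fderiv]
  have hin : ∀ u v, ∀ z ∈ strip s₀, ∀ r : ℝ,
      stripDeriv s₀ v (fun z => r * inner ℝ (K (w z)) (stripDeriv s₀ u w z)) z =
      r * (inner ℝ (K (w z)) (stripDeriv s₀ v (stripDeriv s₀ u w) z) +
        inner ℝ (K (stripDeriv s₀ v w z)) (stripDeriv s₀ u w z)) := by
    intro u v z hz r
    have d1 := hKw.differentiableOn (by norm_num) z hz
    have d2 := (hw2 u).differentiableOn (by norm_num) z hz
    have := (d1.hasFDerivWithinAt.inner ℝ d2.hasFDerivWithinAt).const_mul r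
    rw [this.stripDeriv_eq hz v, ← hKv v z hz, ← stripDeriv_inner hz d1 d2 v,
      (d1.hasFDerivWithinAt.inner ℝ d2.hasFDerivWithinAt).stripDeriv_eq hz v]
    rfl
  have hsum : ∀ z ∈ strip s₀, stripDeriv s₀ (1, 0) f z + stripDeriv s₀ (0, 1) g z =
      energyDensity K s₀ w z := by
    intro z hz
    rw [hf, hg, hin _ _ z hz, hin _ _ z hz,
      stripDeriv_comm (hw.of_le (by norm_num)) (1, 0) (0, 1) hz,
      hK.inner_swap (stripDeriv s₀ (0, 1) w z), energyDensity]
    ring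
  have hsubu : uIcc a b ×ˢ uIcc (0 : ℝ) 1 ⊆ strip s₀ := by
    rw [uIcc_of_le hab, uIcc_of_le zero_le_one]; exact Icc_prod_subset_strip ha
  have hint : Ioo (min a b) (max a b) ×ˢ Ioo (min (0 : ℝ) 1) (max 0 1) ⊆ interior (strip s₀) := by
    rw [min_eq_left hab, max_eq_right hab, min_eq_left zero_le_one, max_eq_right zero_le_one,
      interior_strip]
    exact prod_mono (fun x hx => ha.trans_lt hx.1) Subset.rfl
  have hdiff : ∀ {φ : ℝ × ℝ → ℝ}, ContDiffOn ℝ 2 φ (strip s₀) →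
      ∀ x ∈ Ioo (min a b) (max a b) ×ˢ Ioo (min (0 : ℝ) 1) (max 0 1),
        HasFDerivAt φ (fderivWithin ℝ φ (strip s₀) x) x := by
    intro φ hφ x hx
    exact ((hφ.differentiableOn (by norm_num) x (interior_subset (hint hx))).hasFDerivWithinAt
      ).hasFDerivAt (mem_interior_iff_mem_nhds.1 (hint hx))
  have hdiv := integral2_divergence_prod_of_hasFDerivAt f g (fderivWithin ℝ f (strip s₀))
    (fderivWithin ℝ g (strip s₀)) a 0 b 1 (hfc.continuousOn.mono hsubu)
    (hgc.continuousOn.mono hsubu) (hdiff hfc) (hdiff hgc) ?_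
  -- The horizontal sides contribute nothing: `w` and `∂ₛw` both lie in the linear Lagrangian.
  · have hgz : ∀ t ∈ Icc (0 : ℝ) 1, ∀ {P : E →L[ℝ] E}, IsLagrangianProjection K P →
        (∀ s ∈ Ici s₀, P (w (s, t)) = w (s, t)) → ∫ s in a..b, g (s, t) = 0 := by
      intro t ht P hP hPw
      refine intervalIntegral.integral_zero_ae (ae_of_all _ fun s hs => ?_)
      rw [uIoc_of_le hab] at hs
      have hs' : s ∈ Ici s₀ := ha.trans hs.1.le
      simp only [hg]
      rw [hP.inner_eq_zero (hPw s hs') (proj_stripDeriv_fst hwd ht hPw hs'), mul_zero]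
    rw [hgz 1 (by simp) hP₁ h1, hgz 0 (by simp) hP₀ h0, sub_zero, zero_add] at hdiv
    have e1 : ∀ s, stripAction K s₀ w s = ∫ t in (0 : ℝ)..1, f (s, t) := fun s => by
      rw [stripAction, ← intervalIntegral.integral_const_mul]
    rw [e1, e1, ← hdiv]
    refine intervalIntegral.integral_congr fun s hs => ?_
    refine intervalIntegral.integral_congr fun t ht => ?_
    exact hsum (s, t) (hsubu ⟨hs, ht⟩)
  · have hc : ContinuousOn (fun x => fderivWithin ℝ f (strip s₀) x (1, 0) +
        fderivWithin ℝ g (strip s₀) x (0, 1)) (uIcc a b ×ˢ uIcc (0 : ℝ) 1) :=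
      (((hfc.stripDeriv (l := 1) (by norm_num) (1, 0)).continuousOn).add
        ((hgc.stripDeriv (l := 1) (by norm_num) (0, 1)).continuousOn)).mono hsubu
    exact hc.integrableOn_compact (isCompact_uIcc.prod isCompact_uIcc)

variable {A : ℝ × E → E →L[ℝ] E} {ρ κ L : ℝ}

/-- Substituting `∂ₛw = -A ∂ₜw` turns the density into `⟪K ∂ₜw, A ∂ₜw⟫`, to which coercivity
applies. -/
lemma IsLocalHolomorphic.mul_norm_sq_le_energyDensity (hK : IsOrthogonalComplexStructure K)
    (h : IsLocalHolomorphic A ρ s₀ w)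
    (hκ : ∀ z ∈ strip s₀, ∀ v, κ * ‖v‖ ^ 2 ≤ inner ℝ (K v) (A (z.2, w z) v)) {z : ℝ × ℝ}
    (hz : z ∈ strip s₀) :
    κ * ‖stripDeriv s₀ (0, 1) w z‖ ^ 2 ≤ energyDensity K s₀ w z := by
  refine (hκ z hz _).trans_eq ?_
  rw [energyDensity, hK.inner_swap (stripDeriv s₀ (1, 0) w z), h.deriv_fst z hz, inner_neg_right,
    neg_neg]

/-- The energy density of a holomorphic strip of finite area with Lagrangian boundary values has
an exponentially weighted integral. -/
theorem IsLocalHolomorphic.integrableOn_exp_mul_energyDensity [CompleteSpace E]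
    (hK : IsOrthogonalComplexStructure K)
    (hP₀ : IsLagrangianProjection K P₀) (hP₁ : IsLagrangianProjection K P₁)
    (hinter : ∀ v w, P₀ v = v → P₁ w = w → ∃ c, P₀ c = c ∧ P₁ c = c ∧ ‖v - c‖ ≤ ‖w - v‖)
    (h : IsLocalHolomorphic A ρ s₀ w) (hκ0 : 0 < κ)
    (hκ : ∀ z ∈ strip s₀, ∀ v, κ * ‖v‖ ^ 2 ≤ inner ℝ (K v) (A (z.2, w z) v))
    (h0 : ∀ s ∈ Ici s₀, P₀ (w (s, 0)) = w (s, 0)) (h1 : ∀ s ∈ Ici s₀, P₁ (w (s, 1)) = w (s, 1))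
    (harea : IntegrableOn (energyDensity K s₀ w) (strip s₀)) :
    IntegrableOn (fun z => Real.exp (κ / 2 * z.1) * energyDensity K s₀ w z) (strip s₀) := by
  have hw := h.contDiffOn
  have hwd := hw.differentiableOn (by norm_num)
  have hec := continuousOn_energyDensity (K := K) hw
  have hdens := fun z (hz : z ∈ strip s₀) => h.mul_norm_sq_le_energyDensity hK hκ hz
  have he0 : ∀ z ∈ strip s₀, 0 ≤ energyDensity K s₀ w z := fun z hz =>
    le_trans (by positivity) (hdens z hz)
  -- Composing with a retraction onto the strip extends the density continuously to the plane, so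
  -- the slice energy is continuous on `ℝ` and its primitive differentiable everywhere.
  set ret : ℝ × ℝ → ℝ × ℝ := fun z => (max s₀ z.1, (projIcc (0 : ℝ) 1 zero_le_one z.2 : ℝ)) with hret
  have hretc : Continuous ret := by
    refine Continuous.prodMk (by fun_prop) ?_
    exact continuous_subtype_val.comp (continuous_projIcc.comp continuous_snd)
  have hrets : ∀ z, ret z ∈ strip s₀ := fun z => ⟨mem_Ici.2 (le_max_left s₀ z.1), Subtype.coe_prop _⟩
  have hretid : ∀ z ∈ strip s₀, ret z = z := fun z hz => by
    refine Prod.ext (max_eq_right hz.1) ?_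
    simp [hret, projIcc_of_mem zero_le_one hz.2]
  set ε : ℝ → ℝ → ℝ := fun s t => energyDensity K s₀ w (ret (s, t)) with hε
  have hεc : Continuous (fun z : ℝ × ℝ => ε z.1 z.2) := hec.comp_continuous hretc hrets
  set e : ℝ → ℝ := fun s => ∫ t in (0 : ℝ)..1, ε s t with he
  have hecont : Continuous e := intervalIntegral.continuous_parametric_intervalIntegral_of_continuous'
    hεc 0 1
  have heq : ∀ s ∈ Ici s₀, ∀ t ∈ Icc (0 : ℝ) 1, ε s t = energyDensity K s₀ w (s, t) :=
    fun s hs t ht => by simp only [hε]; rw [hretid (s, t) ⟨hs, ht⟩]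
  have heint : ∀ s ∈ Ici s₀, e s = ∫ t in (0 : ℝ)..1, energyDensity K s₀ w (s, t) := by
    intro s hs
    refine intervalIntegral.integral_congr fun t ht => ?_
    rw [uIcc_of_le zero_le_one] at ht
    exact heq s hs t ht
  set 𝒜 : ℝ → ℝ := fun s => stripAction K s₀ w s₀ + ∫ σ in s₀..s, e σ with hAA
  have hA : ∀ s ∈ Ici s₀, 𝒜 s = stripAction K s₀ w s := by
    intro s hs
    have := stripAction_sub hK hP₀ hP₁ hw h0 h1 le_rfl hs
    have h2 : ∫ σ in s₀..s, e σ = ∫ s in s₀..s, ∫ t in (0 : ℝ)..1, energyDensity K s₀ w (s, t) := by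
      refine intervalIntegral.integral_congr fun σ hσ => ?_
      rw [uIcc_of_le hs] at hσ
      exact heint σ hσ.1
    simp only [hAA]
    rw [h2, ← this]; ring
  have hAd : ∀ s, HasDerivAt 𝒜 (e s) s := fun s =>
    ((hecont.integral_hasStrictDerivAt s₀ s).hasDerivAt).const_add _
  -- The isoperimetric inequality followed by the tameness bound gives the differential inequality
  -- for the action.
  have hiso : ∀ s ≥ s₀, κ * |𝒜 s| ≤ e s := by
    intro s hs
    have hline : ContinuousOn (fun t => (s, t)) (Icc (0 : ℝ) 1) := by fun_prop
    have hmaps : MapsTo (fun t : ℝ => (s, t)) (Icc (0 : ℝ) 1) (strip s₀) := fun t ht => ⟨hs, ht⟩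
    have hdc : ContinuousOn (fun t => stripDeriv s₀ (0, 1) w (s, t)) (Icc (0 : ℝ) 1) :=
      (hw.stripDeriv (l := 2) (by norm_num) (0, 1)).continuousOn.comp hline hmaps
    have a1 := abs_action_le hK hP₀ hP₁ hinter (x := fun t => w (s, t))
      (fun t ht => hasDerivWithinAt_snd hwd hs ht) hdc (h0 s hs) (h1 s hs)
    rw [hA s hs, heint s hs]
    calc κ * |stripAction K s₀ w s| ≤ κ * ∫ t in (0 : ℝ)..1, ‖stripDeriv s₀ (0, 1) w (s, t)‖ ^ 2 := by
          gcongr; exact a1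
      _ = ∫ t in (0 : ℝ)..1, κ * ‖stripDeriv s₀ (0, 1) w (s, t)‖ ^ 2 := by
          rw [intervalIntegral.integral_const_mul]
      _ ≤ _ := by
          refine intervalIntegral.integral_mono_on zero_le_one ?_ ?_ fun t ht => hdens _ ⟨hs, ht⟩
          · exact ContinuousOn.intervalIntegrable (by
              rw [uIcc_of_le zero_le_one]; exact continuousOn_const.mul (hdc.norm.pow 2))
          · exact ContinuousOn.intervalIntegrable (by
              rw [uIcc_of_le zero_le_one]; exact hec.comp hline hmaps)
  have hrect : ∀ (φ : ℝ × ℝ → ℝ), Continuous φ → ∀ b ≥ s₀,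
      ∫ s in s₀..b, ∫ t in (0 : ℝ)..1, φ (s, t) = ∫ z in Icc s₀ b ×ˢ Icc (0 : ℝ) 1, φ z := by
    intro φ hφ b hb
    have hi : IntegrableOn φ (Icc s₀ b ×ˢ Icc (0 : ℝ) 1) (volume.prod volume) :=
      hφ.continuousOn.integrableOn_compact (isCompact_Icc.prod isCompact_Icc)
    rw [Measure.volume_eq_prod, setIntegral_prod _ hi, intervalIntegral.integral_of_le hb,
      integral_Icc_eq_integral_Ioc]
    simp only [intervalIntegral.integral_of_le (zero_le_one (α := ℝ)), integral_Icc_eq_integral_Ioc]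
  have hMbd : ∀ s ≥ s₀, 𝒜 s ≤ stripAction K s₀ w s₀ + ∫ z in strip s₀, energyDensity K s₀ w z := by
    intro s hs
    simp only [hAA, he]
    gcongr
    rw [hrect (fun z => ε z.1 z.2) hεc s hs]
    calc ∫ z in Icc s₀ s ×ˢ Icc (0 : ℝ) 1, ε z.1 z.2
        = ∫ z in Icc s₀ s ×ˢ Icc (0 : ℝ) 1, energyDensity K s₀ w z :=
          setIntegral_congr_fun (measurableSet_Icc.prod measurableSet_Icc)
            fun z hz => heq z.1 hz.1.1 z.2 hz.2
      _ ≤ _ := by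
          refine setIntegral_mono_set harea ?_ (Icc_prod_subset_strip le_rfl).eventuallyLE
          filter_upwards [ae_restrict_mem (measurableSet_strip s₀)] with z hz using he0 z hz
  have hfin := fun b (hb : s₀ ≤ b) => integral_exp_mul_le_of_deriv_ge hκ0 hecont hAd hiso hMbd hb
  have hWc : ContinuousOn (fun z : ℝ × ℝ => Real.exp (κ / 2 * z.1) * energyDensity K s₀ w z)
      (strip s₀) := ContinuousOn.mul (by fun_prop) hec
  -- Integrability on the strip follows from uniform bounds on the exhausting rectangles, the
  -- integrand being nonnegative.
  have hcover : AECover (volume.restrict (strip s₀)) atTop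
      (fun b : ℝ => (Iic b ×ˢ univ : Set (ℝ × ℝ))) := by
    refine ⟨ae_of_all _ fun z => ?_, fun b => measurableSet_Iic.prod MeasurableSet.univ⟩
    filter_upwards [eventually_ge_atTop z.1] with b hb using ⟨hb, trivial⟩
  have hinter' : ∀ b : ℝ, (Iic b ×ˢ univ : Set (ℝ × ℝ)) ∩ strip s₀ = Icc s₀ b ×ˢ Icc 0 1 := by
    intro b
    ext z
    simp only [strip, mem_inter_iff, mem_prod, mem_Iic, mem_univ, and_true, mem_Ici, mem_Icc]
    tauto
  refine hcover.integrable_of_integral_bounded_of_nonneg_ae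
    (-2 * Real.exp (κ / 2 * s₀) * 𝒜 s₀) ?_ ?_ ?_
  · intro b
    rw [IntegrableOn, Measure.restrict_restrict (measurableSet_Iic.prod MeasurableSet.univ), hinter']
    exact (hWc.mono (Icc_prod_subset_strip le_rfl)).integrableOn_compact
      (isCompact_Icc.prod isCompact_Icc)
  · filter_upwards [ae_restrict_mem (measurableSet_strip s₀)] with z hz
    exact mul_nonneg (Real.exp_pos _).le (he0 z hz)
  · filter_upwards [eventually_ge_atTop s₀] with b hb
    rw [Measure.restrict_restrict (measurableSet_Iic.prod MeasurableSet.univ), hinter']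
    refine le_trans (le_of_eq ?_) (hfin b hb)
    have := hrect (fun z => Real.exp (κ / 2 * z.1) * ε z.1 z.2) (by fun_prop) b hb
    simp only [intervalIntegral.integral_const_mul] at this
    rw [this]
    refine setIntegral_congr_fun (measurableSet_Icc.prod measurableSet_Icc) fun z hz => ?_
    simp only [heq z.1 hz.1.1 z.2 hz.2]

/-- Almost every horizontal line of a holomorphic strip of finite area which converges to the
origin converges exponentially. -/
theorem IsLocalHolomorphic.ae_exists_decay [CompleteSpace E]
    (hK : IsOrthogonalComplexStructure K)
    (hP₀ : IsLagrangianProjection K P₀) (hP₁ : IsLagrangianProjection K P₁)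
    (hinter : ∀ v w, P₀ v = v → P₁ w = w → ∃ c, P₀ c = c ∧ P₁ c = c ∧ ‖v - c‖ ≤ ‖w - v‖)
    (h : IsLocalHolomorphic A ρ s₀ w) (hκ0 : 0 < κ)
    (hκ : ∀ z ∈ strip s₀, ∀ v, κ * ‖v‖ ^ 2 ≤ inner ℝ (K v) (A (z.2, w z) v))
    (hAL : ∀ z ∈ strip s₀, ‖A (z.2, w z)‖ ≤ L)
    (h0 : ∀ s ∈ Ici s₀, P₀ (w (s, 0)) = w (s, 0)) (h1 : ∀ s ∈ Ici s₀, P₁ (w (s, 1)) = w (s, 1))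
    (harea : IntegrableOn (energyDensity K s₀ w) (strip s₀))
    (hlim : ∀ ε > 0, ∃ s₁, ∀ s ≥ s₁, ∀ t ∈ Icc (0 : ℝ) 1, ‖w (s, t)‖ ≤ ε) :
    ∀ᵐ t ∂(volume.restrict (Icc (0 : ℝ) 1)),
      ∃ c, ∀ s ∈ Ici s₀, ‖w (s, t)‖ ≤ c * Real.exp (-(κ / 4) * s) := by
  have hint := h.integrableOn_exp_mul_energyDensity hK hP₀ hP₁ hinter hκ0 hκ h0 h1 harea
  rw [IntegrableOn, strip, Measure.volume_eq_prod, ← Measure.prod_restrict] at hint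
  -- Fubini: for almost every `t` the weighted density is integrable in `s`.
  filter_upwards [hint.prod_left_ae, ae_restrict_mem measurableSet_Icc] with t ht htI
  have hwd := h.contDiffOn.differentiableOn (by norm_num)
  have hdens := fun s (hs : s ∈ Ici s₀) =>
    h.mul_norm_sq_le_energyDensity hK hκ (z := (s, t)) ⟨hs, htI⟩
  refine exists_norm_le_exp_of_integrable (x' := fun s => stripDeriv s₀ (1, 0) w (s, t))
    (e := fun s => energyDensity K s₀ w (s, t)) (Λ := L ^ 2 / κ) hκ0
    (fun s hs => hasDerivWithinAt_fst hwd hs htI) ?_ ?_ (by positivity) ?_ ht ?_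
  · exact (h.contDiffOn.stripDeriv (l := 2) (by norm_num) (1, 0)).continuousOn.comp
      (by fun_prop) fun s hs => ⟨hs, htI⟩
  · exact fun s hs => le_trans (by positivity) (hdens s hs)
  · intro s hs
    have hz : (s, t) ∈ strip s₀ := ⟨hs, htI⟩
    have a1 : ‖stripDeriv s₀ (1, 0) w (s, t)‖ ≤ L * ‖stripDeriv s₀ (0, 1) w (s, t)‖ := by
      rw [h.deriv_fst _ hz, norm_neg]
      exact (ContinuousLinearMap.le_opNorm _ _).trans (by gcongr; exact hAL _ hz)
    calc ‖stripDeriv s₀ (1, 0) w (s, t)‖ ^ 2 ≤ (L * ‖stripDeriv s₀ (0, 1) w (s, t)‖) ^ 2 := by gcongr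
      _ = L ^ 2 / κ * (κ * ‖stripDeriv s₀ (0, 1) w (s, t)‖ ^ 2) := by field_simp
      _ ≤ _ := by gcongr; exact hdens s hs
  · rw [Metric.tendsto_atTop]
    intro ε hε
    obtain ⟨s₁, hs₁⟩ := hlim (ε / 2) (by positivity)
    refine ⟨s₁, fun s hs => ?_⟩
    rw [dist_zero_right]
    exact (hs₁ s hs t htI).trans_lt (by linarith)

end Energy

/-! ### From almost every line to all lines, by thin substrips and compactness. -/

section LocalDecay

variable {E : Type*} [NormedAddCommGroup E] [InnerProductSpace ℝ E] {K P₀ P₁ : E →L[ℝ] E}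

lemma IsCompact.exists_pos_forall_le {X : Type*} [TopologicalSpace X] {S : Set X} (hS : IsCompact S)
    {f : X → ℝ} (hf : ContinuousOn f S) (hpos : ∀ x ∈ S, 0 < f x) : ∃ κ > 0, ∀ x ∈ S, κ ≤ f x := by
  rcases S.eq_empty_or_nonempty with rfl | hne
  · exact ⟨1, one_pos, by simp⟩
  · obtain ⟨x, hx, hmin⟩ := hS.exists_isMinOn hne hf
    exact ⟨f x, hpos x hx, fun y hy => hmin hy⟩

/-- Compactness of `S` times the unit sphere gives a positive minimum, and both sides are quadratic
in `v`. -/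
lemma exists_coercive [FiniteDimensional ℝ E] {A : ℝ × E → E →L[ℝ] E} {S : Set (ℝ × E)}
    (hS : IsCompact S) (hA : ContinuousOn A S)
    (htame : ∀ x ∈ S, ∀ v ≠ 0, 0 < inner ℝ (K v) (A x v)) :
    ∃ κ > 0, ∀ x ∈ S, ∀ v, κ * ‖v‖ ^ 2 ≤ inner ℝ (K v) (A x v) := by
  have hc : ContinuousOn (fun q : (ℝ × E) × E => inner ℝ (K q.2) (A q.1 q.2))
      (S ×ˢ Metric.sphere 0 1) := by
    have h1 : ContinuousOn (fun q : (ℝ × E) × E => A q.1) (S ×ˢ Metric.sphere 0 1) :=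
      hA.comp continuousOn_fst fun q hq => hq.1
    exact ContinuousOn.inner (by fun_prop) (h1.clm_apply continuousOn_snd)
  obtain ⟨κ, hκ, h⟩ := (hS.prod (isCompact_sphere (0 : E) 1)).exists_pos_forall_le hc
    fun q hq => htame q.1 hq.1 q.2 (ne_zero_of_mem_unit_sphere ⟨q.2, hq.2⟩)
  refine ⟨κ, hκ, fun x hx v => ?_⟩
  rcases eq_or_ne v 0 with rfl | hv
  · simp
  · have hn : ‖v‖ ≠ 0 := norm_ne_zero_iff.2 hv
    have := h (x, (‖v‖)⁻¹ • v) ⟨hx, by simp [norm_smul, hn]⟩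
    simp only [map_smul, inner_smul_left, inner_smul_right, conj_trivial] at this
    calc κ * ‖v‖ ^ 2 ≤ (‖v‖⁻¹ * (‖v‖⁻¹ * inner ℝ (K v) (A x v))) * ‖v‖ ^ 2 := by gcongr
      _ = inner ℝ (K v) (A x v) := by field_simp

/-- Supplies decaying lines as sides of arbitrarily thin substrips. -/
lemma exists_mem_Ioo_of_ae {p : ℝ → Prop} (hp : ∀ᵐ t ∂(volume.restrict (Icc (0 : ℝ) 1)), p t)
    {a b : ℝ} (hab : a < b) (ha : 0 ≤ a) (hb : b ≤ 1) : ∃ t ∈ Ioo a b, p t := by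
  have hsub : Ioo a b ⊆ Icc (0 : ℝ) 1 := Ioo_subset_Icc_self.trans (Icc_subset_Icc ha hb)
  have h1 : ∀ᵐ t ∂(volume.restrict (Ioo a b)), p t := ae_mono (Measure.restrict_mono hsub le_rfl) hp
  have h2 := h1.and (ae_restrict_mem measurableSet_Ioo)
  have : (ae (volume.restrict (Ioo a b))).NeBot := by
    rw [ae_neBot, Ne, Measure.restrict_eq_zero, Real.volume_Ioo, ENNReal.ofReal_eq_zero, not_le]
    linarith
  obtain ⟨t, ht, htI⟩ := h2.exists
  exact ⟨t, htI, ht⟩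

/-- Exponential decay of holomorphic strips in a ball with linear Lagrangian boundary conditions. -/
theorem exists_local_decay [FiniteDimensional ℝ E] {ρ : ℝ} (hρ : 0 < ρ)
    (hK : IsOrthogonalComplexStructure K)
    (hP₀ : IsLagrangianProjection K P₀) (hP₁ : IsLagrangianProjection K P₁)
    (hinter : ∀ v w, P₀ v = v → P₁ w = w → ∃ c, P₀ c = c ∧ P₁ c = c ∧ ‖v - c‖ ≤ ‖w - v‖)
    {A : ℝ × E → E →L[ℝ] E} (hA : ContDiffOn ℝ 3 A (timeBall E ρ))
    (htame : ∀ x ∈ timeBall E ρ, ∀ v ≠ 0, 0 < inner ℝ (K v) (A x v)) :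
    ∃ γ > 0, ∃ r > 0, ∀ s₀ w, IsLocalHolomorphic A ρ s₀ w →
      (∀ z ∈ strip s₀, ‖w z‖ ≤ r) →
      (∀ s ∈ Ici s₀, P₀ (w (s, 0)) = w (s, 0)) → (∀ s ∈ Ici s₀, P₁ (w (s, 1)) = w (s, 1)) →
      IntegrableOn (energyDensity K s₀ w) (strip s₀) →
      (∀ ε > 0, ∃ s₁, ∀ s ≥ s₁, ∀ t ∈ Icc (0 : ℝ) 1, ‖w (s, t)‖ ≤ ε) →
      ∃ c, ∀ s ∈ Ici s₀, ∀ t ∈ Icc (0 : ℝ) 1, ‖w (s, t)‖ ≤ c * Real.exp (-γ * s) := by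
  have : CompleteSpace E := FiniteDimensional.complete ℝ E
  have hslice : ∀ t ∈ Icc (0 : ℝ) 1, ContDiffAt ℝ 3 (fun y => A (t, y)) 0 := by
    intro t ht
    have h1 : ContDiffOn ℝ 3 (fun y => A (t, y)) (Metric.ball 0 ρ) :=
      hA.comp (contDiff_prodMk_right t).contDiffOn fun y hy => ⟨ht, hy⟩
    exact h1.contDiffAt (Metric.ball_mem_nhds _ hρ)
  have h00 : (0 : E) ∈ Metric.ball (0 : E) ρ := Metric.mem_ball_self hρ
  have hmem0 : (0 : ℝ) ∈ Icc (0 : ℝ) 1 := by simp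
  have hmem1 : (1 : ℝ) ∈ Icc (0 : ℝ) 1 := by simp
  obtain ⟨G₀, C₀, hC₀, hG₀⟩ := exists_straightening hK hP₀ (fun y => A (0, y)) (hslice 0 hmem0)
    (htame (0, 0) ⟨hmem0, h00⟩)
  obtain ⟨G₁, C₁, hC₁, hG₁⟩ := exists_straightening hK hP₁ (fun y => A (1, y)) (hslice 1 hmem1)
    (htame (1, 0) ⟨hmem1, h00⟩)
  obtain ⟨d, hd, hball⟩ := Metric.eventually_nhds_iff_ball.1 (hG₀.and hG₁)
  -- Halving the radius gives a compact set on which `A`, its derivative and its coercivity have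
  -- uniform constants, independent of `w`.
  set S : Set (ℝ × E) := Icc 0 1 ×ˢ Metric.closedBall 0 (ρ / 2) with hS
  have hSc : IsCompact S := isCompact_Icc.prod (isCompact_closedBall _ _)
  have hSsub : S ⊆ timeBall E ρ :=
    prod_mono Subset.rfl (Metric.closedBall_subset_ball (by linarith))
  obtain ⟨κ, hκ0, hκ⟩ := exists_coercive hSc (hA.continuousOn.mono hSsub)
    fun x hx => htame x (hSsub hx)
  obtain ⟨L₁, hL₁⟩ := hSc.exists_bound_of_continuousOn (hA.continuousOn.mono hSsub)
  obtain ⟨L₂, hL₂⟩ := hSc.exists_bound_of_continuousOn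
    ((hA.continuousOn_fderivWithin (uniqueDiffOn_timeBall ρ) (by norm_num)).mono hSsub)
  set L := max L₂ 0 with hL
  have hL0 : 0 ≤ L := le_max_right _ _
  set r := min (min (ρ / 2) (d / 2))
    (min (1 / (2 * C₀ ^ 4 * (1 + L))) (1 / (2 * C₁ ^ 4 * (1 + L)))) with hr
  have hr0 : 0 < r := by
    refine lt_min (lt_min ?_ ?_) (lt_min ?_ ?_) <;> positivity
  have hrρ : r ≤ ρ / 2 := (min_le_left _ _).trans (min_le_left _ _)
  have hrd : r ≤ d / 2 := (min_le_left _ _).trans (min_le_right _ _)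
  have hrC₀ : 2 * C₀ ^ 4 * (1 + L) * r ≤ 1 := by
    have : r ≤ 1 / (2 * C₀ ^ 4 * (1 + L)) := (min_le_right _ _).trans (min_le_left _ _)
    rwa [le_div_iff₀ (by positivity), mul_comm] at this
  have hrC₁ : 2 * C₁ ^ 4 * (1 + L) * r ≤ 1 := by
    have : r ≤ 1 / (2 * C₁ ^ 4 * (1 + L)) := (min_le_right _ _).trans (min_le_right _ _)
    rwa [le_div_iff₀ (by positivity), mul_comm] at this
  refine ⟨κ / 4, by positivity, r, hr0, ?_⟩
  intro s₀ w h hwr h0 h1 harea hlim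
  have hwS : ∀ z ∈ strip s₀, (z.2, w z) ∈ S := fun z hz =>
    ⟨hz.2, by rw [mem_closedBall_zero_iff]; exact (hwr z hz).trans hrρ⟩
  have hwd : ∀ z ∈ strip s₀, w z ∈ Metric.ball 0 d := fun z hz => by
    rw [mem_ball_zero_iff]; exact (hwr z hz).trans_lt (by linarith)
  have hgood := h.ae_exists_decay hK hP₀ hP₁ hinter hκ0 (fun z hz => hκ _ (hwS z hz))
    (fun z hz => hL₁ _ (hwS z hz)) h0 h1 harea hlim
  have hAL : ∀ z ∈ strip s₀, ‖fderivWithin ℝ A (timeBall E ρ) (z.2, w z)‖ ≤ L :=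
    fun z hz => (hL₂ _ (hwS z hz)).trans (le_max_left _ _)
  set Q := C₀ ^ 4 * L ^ 2 + C₁ ^ 4 * L ^ 2 + (2 * (κ / 4)) ^ 2 + 1 with hQ
  have hQ0 : 0 < Q := by positivity
  have hQ₀ : C₀ ^ 4 * L ^ 2 + (2 * (κ / 4)) ^ 2 < Q := by
    have : 0 ≤ C₁ ^ 4 * L ^ 2 := by positivity
    linarith
  have hQ₁ : C₁ ^ 4 * L ^ 2 + (2 * (κ / 4)) ^ 2 < Q := by
    have : 0 ≤ C₀ ^ 4 * L ^ 2 := by positivity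
    linarith
  -- Substrips of width at most `2δ` are thin enough for the barrier with curvature `Q`, wherever in
  -- the substrip `τ` lies.
  obtain ⟨δ, hδ0, hδ1, hδ⟩ : ∃ δ > 0, δ ≤ 1 ∧ ∀ x : ℝ, |x| ≤ 2 * δ → Q * x ^ 2 ≤ 1 := by
    refine ⟨min 1 (1 / (2 * Real.sqrt Q)), by positivity, min_le_left _ _, fun x hx => ?_⟩
    have hx2 : |x| ≤ 1 / Real.sqrt Q := by
      refine hx.trans ?_
      have := min_le_right 1 (1 / (2 * Real.sqrt Q))
      calc 2 * min 1 (1 / (2 * Real.sqrt Q)) ≤ 2 * (1 / (2 * Real.sqrt Q)) := by gcongr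
        _ = _ := by field_simp
    calc Q * x ^ 2 = Q * |x| ^ 2 := by rw [sq_abs]
      _ ≤ Q * (1 / Real.sqrt Q) ^ 2 := by gcongr
      _ = 1 := by rw [div_pow, Real.sq_sqrt hQ0.le]; field_simp
  have hsub₀ := fun (a b τ : ℝ) => h.exists_decay_substrip (B := fun y => A (0, y)) (γ := κ / 4) (Q := Q)
    (a := a) (b := b) (τ := τ) hA hP₀ hC₀ hL0 hrC₀ (fun z hz => (hball _ (hwd z hz)).1)
    hAL hwr hlim
  have hsub₁ := fun (a b τ : ℝ) => h.exists_decay_substrip (B := fun y => A (1, y)) (γ := κ / 4) (Q := Q)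
    (a := a) (b := b) (τ := τ) hA hP₁ hC₁ hL0 hrC₁ (fun z hz => (hball _ (hwd z hz)).2)
    hAL hwr hlim
  have hlocal : ∀ t ∈ Icc (0 : ℝ) 1, ∃ U ∈ 𝓝[Icc (0 : ℝ) 1] t,
      ∃ c, ∀ s ∈ Ici s₀, ∀ t' ∈ U, ‖w (s, t')‖ ≤ c * Real.exp (-(κ / 4) * s) := by
    intro t ht
    rcases ht.1.eq_or_lt with rfl | ht0
    · obtain ⟨b, hb, hbg⟩ := exists_mem_Ioo_of_ae hgood hδ0 le_rfl hδ1
      refine ⟨Icc 0 b, nhdsWithin_mono 0 Icc_subset_Ici_self (Icc_mem_nhdsGE hb.1), ?_⟩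
      refine hsub₀ 0 b 0 hb.1 le_rfl (hb.2.le.trans hδ1) hQ₀ (fun t' ht' => hδ _ ?_) ?_
      · rw [sub_zero, abs_of_nonneg ht'.1]; linarith [ht'.2, hb.2]
      · rintro t' (rfl | rfl)
        · exact Or.inr ⟨rfl, h0, fun _ => rfl⟩
        · exact Or.inl hbg
    rcases ht.2.eq_or_lt with rfl | ht1
    · obtain ⟨a, ha, hag⟩ := exists_mem_Ioo_of_ae hgood (a := 1 - δ) (b := 1) (by linarith)
        (by linarith) le_rfl
      have ha0 : 0 ≤ a := by linarith [ha.1]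
      refine ⟨Icc a 1, nhdsWithin_mono 1 Icc_subset_Iic_self (Icc_mem_nhdsLE ha.2), ?_⟩
      refine hsub₁ a 1 1 ha.2 ha0 le_rfl hQ₁ (fun t' ht' => hδ _ ?_) ?_
      · rw [abs_sub_comm, abs_of_nonneg (by linarith [ht'.2])]; linarith [ht'.1, ha.1]
      · rintro t' (rfl | rfl)
        · exact Or.inl hag
        · exact Or.inr ⟨rfl, h1, fun _ => rfl⟩
    · obtain ⟨a, ha, hag⟩ := exists_mem_Ioo_of_ae hgood (a := max 0 (t - δ)) (b := t)
        (max_lt ht0 (by linarith)) (le_max_left _ _) ht.2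
      obtain ⟨b, hb, hbg⟩ := exists_mem_Ioo_of_ae hgood (a := t) (b := min 1 (t + δ))
        (lt_min ht1 (by linarith)) ht.1 (min_le_left _ _)
      have ha0 : 0 ≤ a := (le_max_left _ _).trans ha.1.le
      have ha1 : t - δ < a := (le_max_right _ _).trans_lt ha.1
      have hb0 : b ≤ 1 := hb.2.le.trans (min_le_left _ _)
      have hb1 : b < t + δ := hb.2.trans_le (min_le_right _ _)
      refine ⟨Icc a b, mem_nhdsWithin_of_mem_nhds (Icc_mem_nhds ha.2 hb.1), ?_⟩
      -- Both sides are decaying lines, so no boundary property of the straightening is needed and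
      -- either one would serve.
      refine hsub₀ a b a (ha.2.trans hb.1) ha0 hb0 hQ₀ (fun t' ht' => hδ _ ?_) ?_
      · rw [abs_of_nonneg (by linarith [ht'.1])]; linarith [ht'.2]
      · rintro t' (rfl | rfl)
        · exact Or.inl hag
        · exact Or.inl hbg
  refine isCompact_Icc.induction_on
    (p := fun U => ∃ c, ∀ s ∈ Ici s₀, ∀ t' ∈ U, ‖w (s, t')‖ ≤ c * Real.exp (-(κ / 4) * s))
    ⟨0, by simp⟩ ?_ ?_ hlocal
  · rintro U V hUV ⟨c, hc⟩
    exact ⟨c, fun s hs t ht => hc s hs t (hUV ht)⟩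
  · rintro U V ⟨c, hc⟩ ⟨c', hc'⟩
    refine ⟨max c c', fun s hs t ht => ?_⟩
    rcases ht with ht | ht
    · exact (hc s hs t ht).trans (by gcongr; exact le_max_left _ _)
    · exact (hc' s hs t ht).trans (by gcongr; exact le_max_right _ _)

end LocalDecay

/-! ### Reduction to a chart -/

section Reduction

variable {n : ℕ}

section Chart

variable {X : Type*} [TopologicalSpace X] [ChartedSpace (PhaseSpace n) X]
  {φ : OpenPartialHomeomorph X (PhaseSpace n)}

lemma mdifferentiable_of_mem_maximalAtlas
    (hφ : φ ∈ IsManifold.maximalAtlas 𝓘(ℝ, PhaseSpace n) ∞ X) :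
    φ.MDifferentiable 𝓘(ℝ, PhaseSpace n) 𝓘(ℝ, PhaseSpace n) :=
  ⟨(contMDiffOn_of_mem_maximalAtlas hφ).mdifferentiableOn (by simp),
    (contMDiffOn_symm_of_mem_maximalAtlas hφ).mdifferentiableOn (by simp)⟩

/-- The derivative of a chart, with values in the model space. -/
noncomputable def chartDeriv (φ : OpenPartialHomeomorph X (PhaseSpace n)) (x : X) :
    TangentSpace 𝓘(ℝ, PhaseSpace n) x →L[ℝ] PhaseSpace n :=
  mfderiv 𝓘(ℝ, PhaseSpace n) 𝓘(ℝ, PhaseSpace n) φ x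

lemma endoInChart_chartDeriv (hφ : φ.MDifferentiable 𝓘(ℝ, PhaseSpace n) 𝓘(ℝ, PhaseSpace n))
    (B : ∀ x : X, TangentSpace 𝓘(ℝ, PhaseSpace n) x →L[ℝ] TangentSpace 𝓘(ℝ, PhaseSpace n) x)
    {x : X} (hx : x ∈ φ.source) (v : TangentSpace 𝓘(ℝ, PhaseSpace n) x) :
    endoInChart B φ (φ x) (chartDeriv φ x v) = chartDeriv φ x (B x v) := by
  obtain ⟨y, hy, rfl⟩ : ∃ y ∈ φ.target, φ.symm y = x := ⟨φ x, φ.map_source hx, φ.left_inv hx⟩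
  rw [φ.right_inv hy]
  have h1 := hφ.symm_comp_deriv hx
  rw [φ.right_inv hy] at h1
  have h2 : mfderiv 𝓘(ℝ, PhaseSpace n) 𝓘(ℝ, PhaseSpace n) φ.symm y
      (mfderiv 𝓘(ℝ, PhaseSpace n) 𝓘(ℝ, PhaseSpace n) φ (φ.symm y) v) = v :=
    DFunLike.congr_fun h1 v
  exact congrArg (fun u => chartDeriv φ (φ.symm y) (B (φ.symm y) u)) h2

lemma exists_chartDeriv_eq (hφ : φ.MDifferentiable 𝓘(ℝ, PhaseSpace n) 𝓘(ℝ, PhaseSpace n))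
    {y : PhaseSpace n} (hy : y ∈ φ.target) (v : PhaseSpace n) :
    ∃ x ∈ φ.source, φ x = y ∧ ∃ u : TangentSpace 𝓘(ℝ, PhaseSpace n) x, chartDeriv φ x u = v := by
  refine ⟨φ.symm y, φ.map_target hy, φ.right_inv hy,
    (mfderiv 𝓘(ℝ, PhaseSpace n) 𝓘(ℝ, PhaseSpace n) φ.symm y) v, ?_⟩
  exact DFunLike.congr_fun (hφ.comp_symm_deriv hy) v

variable {Ω : ∀ x : X, (TangentSpace 𝓘(ℝ, PhaseSpace n) x) [⋀^Fin 2]→L[ℝ] ℝ} {L₀ L₁ : Set X}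
  {p : X} {J : ℝ → ∀ x : X,
      TangentSpace 𝓘(ℝ, PhaseSpace n) x →L[ℝ] TangentSpace 𝓘(ℝ, PhaseSpace n) x}

lemma inner_stdJ_chartDeriv (hφ : IsAdaptedDarbouxBall Ω L₀ L₁ p φ) {x : X} (hx : x ∈ φ.source)
    (v w : TangentSpace 𝓘(ℝ, PhaseSpace n) x) :
    inner ℝ (stdJ n (chartDeriv φ x v)) (chartDeriv φ x w) = Ω x ![v, w] := by
  rw [← stdSymplectic_eq_inner]
  exact hφ.darboux x hx v w

lemma tame_endoInChart (hφ : IsAdaptedDarbouxBall Ω L₀ L₁ p φ) (hJ : IsTamedFamily Ω J) {t : ℝ}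
    (ht : t ∈ Icc (0 : ℝ) 1) {y : PhaseSpace n} (hy : y ∈ φ.target) {v : PhaseSpace n}
    (hv : v ≠ 0) : 0 < inner ℝ (stdJ n v) (endoInChart (J t) φ y v) := by
  have hd := mdifferentiable_of_mem_maximalAtlas hφ.mem_maximalAtlas
  obtain ⟨x, hx, rfl, u, rfl⟩ := exists_chartDeriv_eq hd hy v
  rw [endoInChart_chartDeriv hd _ hx, inner_stdJ_chartDeriv hφ hx]
  refine hJ.tamed t ht x u ?_
  rintro rfl
  exact hv (map_zero _)

lemma endoInChart_sq (hφ : φ.MDifferentiable 𝓘(ℝ, PhaseSpace n) 𝓘(ℝ, PhaseSpace n))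
    (hJ : IsTamedFamily Ω J) {t : ℝ} (ht : t ∈ Icc (0 : ℝ) 1) {y : PhaseSpace n}
    (hy : y ∈ φ.target) (v : PhaseSpace n) :
    endoInChart (J t) φ y (endoInChart (J t) φ y v) = -v := by
  obtain ⟨x, hx, rfl, u, rfl⟩ := exists_chartDeriv_eq hφ hy v
  rw [endoInChart_chartDeriv hφ _ hx, endoInChart_chartDeriv hφ _ hx, hJ.sq_eq_neg t ht, map_neg]

lemma strip_subset_halfStrip {s₀ : ℝ} (hs : 0 ≤ s₀) : strip s₀ ⊆ halfStrip :=
  prod_mono (Ici_subset_Ici.2 hs) Subset.rfl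

lemma hasFDerivWithinAt_chart (hφ : φ.MDifferentiable 𝓘(ℝ, PhaseSpace n) 𝓘(ℝ, PhaseSpace n))
    {u : ℝ × ℝ → X} (hu : MDifferentiableOn 𝓘(ℝ, ℝ × ℝ) 𝓘(ℝ, PhaseSpace n) u halfStrip) {s₀ : ℝ}
    (hs : 0 ≤ s₀) {z : ℝ × ℝ} (hz : z ∈ strip s₀) (hzs : u z ∈ φ.source) :
    HasFDerivWithinAt (fun z => φ (u z)) ((chartDeriv φ (u z)).comp
      (mfderivWithin 𝓘(ℝ, ℝ × ℝ) 𝓘(ℝ, PhaseSpace n) u halfStrip z)) (strip s₀) z := by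
  have h1 := ((hu z (strip_subset_halfStrip hs hz)).hasMFDerivWithinAt).mono
    (strip_subset_halfStrip hs)
  have h2 := (hφ.mdifferentiableAt hzs).hasMFDerivAt
  exact (h2.comp_hasMFDerivWithinAt z h1).hasFDerivWithinAt

lemma stripDeriv_fst_chart (hφ : φ.MDifferentiable 𝓘(ℝ, PhaseSpace n) 𝓘(ℝ, PhaseSpace n))
    {u : ℝ × ℝ → X} (hu : MDifferentiableOn 𝓘(ℝ, ℝ × ℝ) 𝓘(ℝ, PhaseSpace n) u halfStrip) {s₀ : ℝ}
    (hs : 0 ≤ s₀) {z : ℝ × ℝ} (hz : z ∈ strip s₀) (hzs : u z ∈ φ.source) :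
    stripDeriv s₀ (1, 0) (fun z => φ (u z)) z = chartDeriv φ (u z) (partialS u z) :=
  (hasFDerivWithinAt_chart hφ hu hs hz hzs).stripDeriv_eq hz _

lemma stripDeriv_snd_chart (hφ : φ.MDifferentiable 𝓘(ℝ, PhaseSpace n) 𝓘(ℝ, PhaseSpace n))
    {u : ℝ × ℝ → X} (hu : MDifferentiableOn 𝓘(ℝ, ℝ × ℝ) 𝓘(ℝ, PhaseSpace n) u halfStrip) {s₀ : ℝ}
    (hs : 0 ≤ s₀) {z : ℝ × ℝ} (hz : z ∈ strip s₀) (hzs : u z ∈ φ.source) :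
    stripDeriv s₀ (0, 1) (fun z => φ (u z)) z = chartDeriv φ (u z) (partialT u z) :=
  (hasFDerivWithinAt_chart hφ hu hs hz hzs).stripDeriv_eq hz _

theorem isLocalHolomorphic_chart (hφ : IsAdaptedDarbouxBall Ω L₀ L₁ p φ)
    (hJ : IsTamedFamily Ω J) {ρ : ℝ} (hρ : φ.target = Metric.ball 0 ρ) {u : ℝ × ℝ → X}
    (hu : IsHolomorphicHalfStrip J u) {s₀ : ℝ} (hs : 0 ≤ s₀)
    (hus : ∀ z ∈ strip s₀, u z ∈ φ.source) :
    IsLocalHolomorphic (fun q : ℝ × PhaseSpace n => endoInChart (J q.1) φ q.2) ρ s₀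
      (fun z => φ (u z)) := by
  have hd := mdifferentiable_of_mem_maximalAtlas hφ.mem_maximalAtlas
  have hud := hu.smooth.mdifferentiableOn (by simp)
  have h1 : ∀ z ∈ strip s₀, stripDeriv s₀ (1, 0) (fun z => φ (u z)) z =
      -endoInChart (J z.2) φ (φ (u z)) (stripDeriv s₀ (0, 1) (fun z => φ (u z)) z) := by
    intro z hz
    rw [stripDeriv_fst_chart hd hud hs hz (hus z hz), stripDeriv_snd_chart hd hud hs hz (hus z hz),
      endoInChart_chartDeriv hd _ (hus z hz), ← map_neg,
      eq_neg_of_add_eq_zero_left (hu.holomorphic z (strip_subset_halfStrip hs hz))]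
  refine ⟨?_, fun z hz => ?_, h1, fun z hz => ?_⟩
  · have h2 : ContMDiffOn 𝓘(ℝ, ℝ × ℝ) 𝓘(ℝ, PhaseSpace n) ∞ (fun z => φ (u z)) (strip s₀) :=
      (contMDiffOn_of_mem_maximalAtlas hφ.mem_maximalAtlas).comp
        (hu.smooth.mono (strip_subset_halfStrip hs)) hus
    exact (contMDiffOn_iff_contDiffOn.1 h2).of_le ENat.LEInfty.out
  · rw [← hρ]; exact φ.map_source (hus z hz)
  · simp only
    rw [h1 z hz, map_neg, endoInChart_sq hd hJ hz.2 (φ.map_source (hus z hz)), neg_neg]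

/-- In Darboux coordinates the area integrand and the energy density agree pointwise. -/
theorem integrableOn_energyDensity_chart (hφ : IsAdaptedDarbouxBall Ω L₀ L₁ p φ)
    {u : ℝ × ℝ → X} (hu : IsHolomorphicHalfStrip J u) (harea : HasFiniteArea Ω u) {s₀ : ℝ}
    (hs : 0 ≤ s₀) (hus : ∀ z ∈ strip s₀, u z ∈ φ.source) :
    IntegrableOn (energyDensity (stdJ n) s₀ fun z => φ (u z)) (strip s₀) := by
  have hd := mdifferentiable_of_mem_maximalAtlas hφ.mem_maximalAtlas
  have hud := hu.smooth.mdifferentiableOn (by simp)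
  refine IntegrableOn.congr_fun (harea.mono_set (strip_subset_halfStrip hs)) (fun z hz => ?_)
    (measurableSet_strip s₀)
  rw [energyDensity, stripDeriv_fst_chart hd hud hs hz (hus z hz),
    stripDeriv_snd_chart hd hud hs hz (hus z hz), inner_stdJ_chartDeriv hφ (hus z hz)]

end Chart

/-! ### Comparison of the Riemannian distance with chart coordinates. -/

section Distance

variable {X : Type*} [EMetricSpace X] [ChartedSpace (PhaseSpace n) X]

/-- The distance to the center of a chart is locally bounded by a multiple of the norm of the
coordinates. -/
theorem exists_edist_le_enorm_chart [IsManifold 𝓘(ℝ, PhaseSpace n) ∞ X]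
    [Bundle.RiemannianBundle (fun x : X => TangentSpace 𝓘(ℝ, PhaseSpace n) x)]
    [IsContMDiffRiemannianBundle 𝓘(ℝ, PhaseSpace n) ∞ (PhaseSpace n)
      (fun x : X => TangentSpace 𝓘(ℝ, PhaseSpace n) x)]
    [IsRiemannianManifold 𝓘(ℝ, PhaseSpace n) X]
    {φ : OpenPartialHomeomorph X (PhaseSpace n)}
    (hφ : φ ∈ IsManifold.maximalAtlas 𝓘(ℝ, PhaseSpace n) ∞ X) {p : X} (hp : p ∈ φ.source)
    (hp0 : φ p = 0) :
    ∃ C : NNReal, ∀ᶠ x in 𝓝 p, edist x p ≤ C * ‖φ x‖ₑ := by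
  have : IsContinuousRiemannianBundle (PhaseSpace n)
      (fun x : X => TangentSpace 𝓘(ℝ, PhaseSpace n) x) := by
    obtain ⟨g, hg, hg'⟩ := IsContMDiffRiemannianBundle.exists_contMDiff
      (IB := 𝓘(ℝ, PhaseSpace n)) (n := ∞) (F := PhaseSpace n)
      (E := fun x : X => TangentSpace 𝓘(ℝ, PhaseSpace n) x)
    exact ⟨⟨g, hg.continuous, hg'⟩⟩
  obtain ⟨C, -, hC⟩ := eventually_riemannianEDist_le_edist_extChartAt 𝓘(ℝ, PhaseSpace n) p
  have hsymm : φ.symm 0 = p := by rw [← hp0, φ.left_inv hp]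
  have h0 : (0 : PhaseSpace n) ∈ φ.target := by rw [← hp0]; exact φ.map_source hp
  -- The distance comparison is available in the preferred chart at `p`. The transition map from `φ`
  -- is `C¹`, hence Lipschitz near `0`.
  have hψ : ContDiffAt ℝ 1 (fun y => extChartAt 𝓘(ℝ, PhaseSpace n) p (φ.symm y)) 0 := by
    have h1 : ContMDiffAt 𝓘(ℝ, PhaseSpace n) 𝓘(ℝ, PhaseSpace n) ∞ φ.symm 0 :=
      contMDiffAt_symm_of_mem_maximalAtlas hφ h0
    have h2 : ContMDiffAt 𝓘(ℝ, PhaseSpace n) 𝓘(ℝ, PhaseSpace n) ∞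
        (extChartAt 𝓘(ℝ, PhaseSpace n) p) (φ.symm 0) := by
      rw [hsymm]; exact contMDiffAt_extChartAt
    exact (contMDiffAt_iff_contDiffAt.1 (h2.comp 0 h1)).of_le (mod_cast le_top)
  obtain ⟨L, t, ht, hL⟩ := hψ.exists_lipschitzOnWith
  refine ⟨C * L, ?_⟩
  have hpre : φ ⁻¹' t ∈ 𝓝 p := by
    refine (φ.continuousAt hp).preimage_mem_nhds ?_
    rwa [hp0]
  filter_upwards [hC, hpre, φ.open_source.mem_nhds hp] with x h1 h2 h3
  rw [edist_comm, IsRiemannianManifold.out (I := 𝓘(ℝ, PhaseSpace n)) p x]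
  refine h1.trans ?_
  have h4 := hL (mem_of_mem_nhds ht) h2
  simp only [hsymm, φ.left_inv h3] at h4
  rw [ENNReal.coe_mul, mul_assoc]
  gcongr
  rwa [edist_zero_left] at h4

/-- On a preconnected set, a continuous map stays at finite distance from a point if it does so
somewhere. -/
lemma edist_lt_top_of_isPreconnected {Y : Type*} [TopologicalSpace Y] {u : Y → X} {S : Set Y}
    (hS : IsPreconnected S) (hu : ContinuousOn u S) {p : X} {z₀ : Y} (hz₀ : z₀ ∈ S)
    (h : edist (u z₀) p < ⊤) {z : Y} (hz : z ∈ S) : edist (u z) p < ⊤ := by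
  have h1 : IsPreconnected (u '' S) := hS.image u hu
  -- Being at finite distance from `p` is both an open and a closed condition.
  have h2 : IsClopen (Metric.eball p ⊤) := ⟨Metric.isClosed_eball_top, Metric.isOpen_eball⟩
  exact h1.subset_isClopen h2 ⟨u z₀, mem_image_of_mem u hz₀, h⟩ (mem_image_of_mem u hz)

end Distance

end Reduction

/-! ### Uniform convergence, and extension of the bound to all `s ≥ 0`. -/

section Convergence

lemma TendstoUniformlyOn.eventually_forall_mem {X ι α : Type*} [UniformSpace X] {F : ι → α → X}
    {p : X} {l : Filter ι} {S : Set α} (h : TendstoUniformlyOn F (fun _ => p) l S) {N : Set X}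
    (hN : N ∈ 𝓝 p) : ∀ᶠ i in l, ∀ a ∈ S, F i a ∈ N := by
  obtain ⟨V, hV, hVN⟩ := UniformSpace.mem_nhds_iff.1 hN
  exact (h V hV).mono fun i hi a ha => hVN (hi a ha)

/-- An exponential bound for large `s` extends to all `s ≥ 0`, if the function is finite and
continuous. -/
lemma exists_exp_bound_of_large {f : ℝ × ℝ → ENNReal} (hf : ContinuousOn f halfStrip)
    (hfin : ∀ z ∈ halfStrip, f z < ⊤) {γ c s₀ : ℝ} (hγ : 0 < γ)
    (h : ∀ s ∈ Ici s₀, ∀ t ∈ Icc (0 : ℝ) 1, f (s, t) ≤ ENNReal.ofReal (c * Real.exp (-γ * s))) :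
    ∃ C : ℝ, 0 < C ∧ ∀ s : ℝ, 0 ≤ s → ∀ t ∈ Icc (0 : ℝ) 1,
      f (s, t) ≤ ENNReal.ofReal (C * Real.exp (-γ * s)) := by
  obtain ⟨D, hD⟩ : ∃ D : ℝ, ∀ s ∈ Icc 0 s₀, ∀ t ∈ Icc (0 : ℝ) 1, f (s, t) ≤ ENNReal.ofReal D := by
    have hsub : Icc 0 s₀ ×ˢ Icc (0 : ℝ) 1 ⊆ halfStrip := prod_mono Icc_subset_Ici_self Subset.rfl
    rcases (Icc 0 s₀ ×ˢ Icc (0 : ℝ) 1).eq_empty_or_nonempty with he | hne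
    · exact ⟨0, fun s hs t ht => absurd (show (s, t) ∈ Icc 0 s₀ ×ˢ Icc (0 : ℝ) 1 from ⟨hs, ht⟩)
        (by simp [he])⟩
    · obtain ⟨z, hz, hmax⟩ := (isCompact_Icc.prod isCompact_Icc).exists_isMaxOn hne (hf.mono hsub)
      refine ⟨(f z).toReal, fun s hs t ht => ?_⟩
      rw [ENNReal.ofReal_toReal (hfin z (hsub hz)).ne]
      exact hmax (show (s, t) ∈ Icc 0 s₀ ×ˢ Icc (0 : ℝ) 1 from ⟨hs, ht⟩)
  -- For `s ≤ s₀` the factor `exp (γ (s₀ - s)) ≥ 1` absorbs the compact bound `D`, and the `1`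
  -- ensures positivity.
  refine ⟨|c| + |D| * Real.exp (γ * s₀) + 1, by positivity, fun s hs t ht => ?_⟩
  rcases le_total s₀ s with h' | h'
  · refine (h s h' t ht).trans (ENNReal.ofReal_le_ofReal ?_)
    gcongr
    have : 0 ≤ |D| * Real.exp (γ * s₀) := by positivity
    linarith [le_abs_self c]
  · refine (hD s ⟨hs, h'⟩ t ht).trans (ENNReal.ofReal_le_ofReal ?_)
    calc D ≤ |D| * 1 := by rw [mul_one]; exact le_abs_self D
      _ ≤ |D| * (Real.exp (γ * s₀) * Real.exp (-γ * s)) := by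
        gcongr
        rw [← Real.exp_add]
        exact Real.one_le_exp (by nlinarith)
      _ = (|D| * Real.exp (γ * s₀)) * Real.exp (-γ * s) := by ring
      _ ≤ _ := by
        gcongr
        linarith [abs_nonneg c]

end Convergence

theorem mainTheorem5 {n : ℕ} {X : Type*} [EMetricSpace X] [ChartedSpace (PhaseSpace n) X]
    [IsManifold 𝓘(ℝ, PhaseSpace n) ∞ X]
    [Bundle.RiemannianBundle (fun x : X => TangentSpace 𝓘(ℝ, PhaseSpace n) x)]
    [IsContMDiffRiemannianBundle 𝓘(ℝ, PhaseSpace n) ∞ (PhaseSpace n)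
      (fun x : X => TangentSpace 𝓘(ℝ, PhaseSpace n) x)]
    [IsRiemannianManifold 𝓘(ℝ, PhaseSpace n) X]
    (Ω : ∀ x : X, (TangentSpace 𝓘(ℝ, PhaseSpace n) x) [⋀^Fin 2]→L[ℝ] ℝ)
    (hOm : IsSymplecticForm Ω)
    (L₀ L₁ : Set X) (hL₀ : IsLagrangian Ω L₀) (hL₁ : IsLagrangian Ω L₁)
    (hclean : IntersectCleanly n L₀ L₁)
    (p : X) (hp : p ∈ L₀ ∩ L₁)
    (φ : OpenPartialHomeomorph X (PhaseSpace n)) (hφ : IsAdaptedDarbouxBall Ω L₀ L₁ p φ)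
    (J : ℝ → ∀ x : X,
      TangentSpace 𝓘(ℝ, PhaseSpace n) x →L[ℝ] TangentSpace 𝓘(ℝ, PhaseSpace n) x)
    (hJ : IsTamedFamily Ω J) :
    ∃ γ : ℝ, 0 < γ ∧
      ∀ u : ℝ × ℝ → X, IsHolomorphicHalfStrip J u →
        (∀ s : ℝ, 0 ≤ s → u (s, 0) ∈ L₀) →
        (∀ s : ℝ, 0 ≤ s → u (s, 1) ∈ L₁) →
        HasFiniteArea Ω u →
        TendstoUniformlyOn (fun s t => u (s, t)) (fun _ => p) atTop (Icc (0 : ℝ) 1) →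
        ∃ c : ℝ, 0 < c ∧ ∀ s : ℝ, 0 ≤ s → ∀ t ∈ Icc (0 : ℝ) 1,
          edist (u (s, t)) p ≤ ENNReal.ofReal (c * Real.exp (-γ * s)) := by
  obtain ⟨ρ, hρ0, hρ⟩ := hφ.ball
  obtain ⟨m, -, hm⟩ := hφ.right_iff
  have hA : ContDiffOn ℝ 3 (fun q : ℝ × PhaseSpace n => endoInChart (J q.1) φ q.2)
      (timeBall (PhaseSpace n) ρ) := by
    have := hJ.smooth φ hφ.mem_maximalAtlas
    rw [hρ] at this
    exact this.of_le ENat.LEInfty.out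
  -- Both Lagrangians are instances of `lagProj`: index `n` gives `L₀`, and index `m` gives `L₁`.
  obtain ⟨γ, hγ, r, hr, hdecay⟩ := exists_local_decay hρ0 (isOrthogonalComplexStructure_stdJ n)
    (isLagrangianProjection_lagProj n n) (isLagrangianProjection_lagProj n m)
    (fun _ _ => exists_mem_inter_norm_sub_le) hA
    (fun x hx v hv => tame_endoInChart hφ hJ hx.1 (by rw [hρ]; exact hx.2) hv)
  obtain ⟨C, hC⟩ := exists_edist_le_enorm_chart hφ.mem_maximalAtlas hφ.mem_source hφ.map_center
  refine ⟨γ, hγ, fun u hu hu0 hu1 harea hlim => ?_⟩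
  have hnear : ∀ ε > 0, {x | ‖φ x‖ ≤ ε} ∈ 𝓝 p := by
    intro ε hε
    have h1 := (φ.continuousAt hφ.mem_source).norm
    have h2 : ∀ᶠ x in 𝓝 p, ‖φ x‖ < ε :=
      h1.eventually_lt continuousAt_const (by simpa [hφ.map_center] using hε)
    exact h2.mono fun x hx => hx.le
  -- Beyond some `s₀` the strip stays in the chart, in the small ball, and where coordinates control
  -- the distance.
  obtain ⟨s₀, hs₀⟩ := eventually_atTop.1 (hlim.eventually_forall_mem
    (inter_mem (inter_mem (φ.open_source.mem_nhds hφ.mem_source) (hnear r hr)) hC))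
  set σ := max s₀ 0 with hσ
  have hσ0 : 0 ≤ σ := le_max_right _ _
  have hmem : ∀ z ∈ strip σ, (u z ∈ φ.source ∧ ‖φ (u z)‖ ≤ r) ∧ edist (u z) p ≤ C * ‖φ (u z)‖ₑ :=
    fun z hz => hs₀ z.1 ((le_max_left _ _).trans hz.1) z.2 hz.2
  have hus : ∀ z ∈ strip σ, u z ∈ φ.source := fun z hz => (hmem z hz).1.1
  have h0mem : (0 : ℝ) ∈ Icc (0 : ℝ) 1 := by simp
  have h1mem : (1 : ℝ) ∈ Icc (0 : ℝ) 1 := by simp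
  obtain ⟨c, hc⟩ := hdecay σ (fun z => φ (u z)) (isLocalHolomorphic_chart hφ hJ hρ hu hσ0 hus)
    (fun z hz => (hmem z hz).1.2)
    (fun s hs => by
      rw [lagProj_eq_self_iff]
      have h1 := (hφ.left_iff _ (hus (s, 0) ⟨hs, h0mem⟩)).1 (hu0 s (hσ0.trans hs))
      exact fun i => ⟨fun _ => h1 i, fun hi => absurd i.2 (not_lt.2 hi)⟩)
    (fun s hs => by
      rw [lagProj_eq_self_iff]
      exact (hm _ (hus (s, 1) ⟨hs, h1mem⟩)).1 (hu1 s (hσ0.trans hs)))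
    (integrableOn_energyDensity_chart hφ hu harea hσ0 hus)
    (fun ε hε => eventually_atTop.1 (hlim.eventually_forall_mem (hnear ε hε)))
  have hcont : ContinuousOn u halfStrip := hu.smooth.continuousOn
  have hlarge : ∀ s ∈ Ici σ, ∀ t ∈ Icc (0 : ℝ) 1,
      edist (u (s, t)) p ≤ ENNReal.ofReal (C * c * Real.exp (-γ * s)) := by
    intro s hs t ht
    refine (hmem (s, t) ⟨hs, ht⟩).2.trans ?_
    rw [mul_assoc, ENNReal.ofReal_mul C.coe_nonneg, ENNReal.ofReal_coe_nnreal]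
    gcongr
    rw [← ofReal_norm]
    exact ENNReal.ofReal_le_ofReal (hc s hs t ht)
  refine exists_exp_bound_of_large (f := fun z => edist (u z) p) ?_ (fun z hz => ?_) hγ hlarge
  · exact (continuous_id.edist continuous_const).comp_continuousOn hcont
  -- The extended distance may be infinite between components. Connectedness carries finiteness from
  -- the far end to the whole half-strip.
  · have hconn : IsPreconnected halfStrip := isPreconnected_Ici.prod isPreconnected_Icc
    refine edist_lt_top_of_isPreconnected hconn hcont (z₀ := (σ, 0)) ⟨hσ0, h0mem⟩ ?_ hz
    exact (hlarge σ self_mem_Ici 0 h0mem).trans_lt ENNReal.ofReal_lt_top
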